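/- Let $G$ be a (simple, possibly disconnected and infinite) graph with vertex set $V$. A \emph{ray} is a one-way infinite path, a \emph{double ray} is a two-way infinite path, and an infinite subpath of either that is itself a ray is a \emph{tail} of it. Two rays are \emph{equivalent} if no finite vertex set separates them; the equivalence classes are the \emph{ends} of $G$. For a finite $X\subseteq V$ and an end $\omega$ let $C(X,\omega)$ be the component of $G-X$ that contains a tail of every ray in $\omega$. The \emph{end space} $\Omega(G)$ is the set of ends with the topology generated by the sets $\{\omega : C(X,\omega)=C\}$, where $X\subseteq V$ is finite and $C$ is a component of $G-X$. A \emph{direction} of $G$ is a map $f$ assigning to every finite $X\subseteq V$ a component $f(X)$ of $G-X$ such that $f(X)\supseteq f(X')$ whenever $X\subseteq X'$; every end $\omega$ defines the direction $f_\omega\colon X\mapsto C(X,\omega)$. A direction $f$ is \emph{countably determined} if there is a countable set $S$ of pairs $(X,C)$, with $X\subseteq V$ finite and $C$ a component of $G-X$, such that for every direction $h\neq f$ some $(X,C)\in S$ satisfies $f(X)=C\neq h(X)$. A vertex $v$ \emph{dominates} an end $\omega$ if for some ray $R\in\omega$ there are infinitely many $v$--$(R-v)$ paths that pairwise meet only in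 $v$. A \emph{sun} centred at an end $\omega$ is a family $(P^i,\omega^i)_{i\in I}$ of pairwise disjoint subgraphs $P^i$ of $G$ and pairwise distinct ends $\omega^i\neq\omega$ such that either every $P^i$ is a double ray with one tail in $\omega$ and another tail in $\omega^i$, or every $P^i$ is a ray in $\omega^i$ whose first vertex dominates $\omega$; it is uncountable if $I$ is. A \emph{star-decomposition of finite adhesion} of $G$ with leaves $I$ is a tree-decomposition of $G$ whose decomposition tree is a star with centre $s$ and set of leaves $I$ such that $V_s\cap V_i$ is finite for every $i\in I$, where $V_s$ is the central part and the $V_i$ are the leaf parts. An end \emph{lives} in a part if each of its rays has infinitely many vertices in that part. \textbf{Theorem.} The map $\omega\mapsto f_\omega$ is a bijection between the ends and the directions of $G$. For every direction $f$ of $G$, with $\omega$ the end satisfying $f_\omega=f$, the following assertions are equivalent: \begin{enumerate} \item[(i)] $f$ is not countably determined in $G$; \item[(ii)] $\Omega(G)$ is not first countable at $\omega$, i.e.\ $\omega$ has no countable neighbourhood base in $\Omega(G)$; \item[(iii)] there is an uncountable sun in $G$ centred at $\omega$; \item[(iv)] $G$ contains either uncountably many disjoint pairwise inequivalent rays all of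 which start at vertices that dominate $\omega$, or uncountably many disjoint double rays, all having one tail in $\omega$ and another not in $\omega$, so that the latter tails are inequivalent for distinct double rays. \end{enumerate} Moreover, if these hold, then there are an uncountable sun $(P^i,\omega^i)_{i\in I}$ in $G$ centred at $\omega$ and a star-decomposition of $G$ of finite adhesion with set of leaves $I$ such that $\omega$ lives in the central part and, for every $i\in I$, the end $\omega^i$ lives in the leaf part $V_i$ and $P^i$ has a tail in $V_i$. -/

import Mathlib

open Topology

universe u

noncomputable section

namespace SimpleGraph

variable {V : Type u} {G : SimpleGraph V}

/-! ### Rays and double rays -/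

/-- A ray of `G`: a one-way infinite path, enumerated from its first vertex. -/
structure Ray (G : SimpleGraph V) where
  vert : ℕ → V
  inj : Function.Injective vert
  adj : ∀ n, G.Adj (vert n) (vert (n + 1))

/-- A double ray of `G`: a two-way infinite path. -/
structure DoubleRay (G : SimpleGraph V) where
  vert : ℤ → V
  inj : Function.Injective vert
  adj : ∀ n, G.Adj (vert n) (vert (n + 1))

/-- The vertex set of a ray. -/
def Ray.verts (R : G.Ray) : Set V := Set.range R.vert

/-- The vertex set of a double ray. -/
def DoubleRay.verts (D : G.DoubleRay) : Set V := Set.range D.vert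

/-- The ray `D 0, D 1, D 2, …` of a double ray `D`. -/
def DoubleRay.fwd (D : G.DoubleRay) : G.Ray where
  vert n := D.vert n
  inj m n h := by simpa using D.inj h
  adj n := by simpa using D.adj n

/-- The ray `D 0, D (-1), D (-2), …` of a double ray `D`. -/
def DoubleRay.bwd (D : G.DoubleRay) : G.Ray where
  vert n := D.vert (-n)
  inj m n h := by simpa using D.inj h
  adj n := by
    have h := (D.adj (-((n : ℤ) + 1))).symm
    have e : -((n : ℤ) + 1) + 1 = -(n : ℤ) := by ring
    rw [e] at h
    simpa using h

/-- Some tail of the ray lies in `A`. -/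
def Ray.HasTailIn (R : G.Ray) (A : Set V) : Prop := ∃ N, ∀ n, N ≤ n → R.vert n ∈ A

/-! ### Ends -/

/-- The finite set `X` separates the rays `R` and `S`: no vertex of `R` outside `X` is joined to a
vertex of `S` outside `X` by a path avoiding `X`. -/
def Ray.SeparatedBy (R S : G.Ray) (X : Finset V) : Prop :=
  ∀ (m n : ℕ) (hm : R.vert m ∉ (X : Set V)) (hn : S.vert n ∉ (X : Set V)),
    G.componentComplMk hm ≠ G.componentComplMk hn

/-- Two rays are equivalent if no finite set of vertices separates them. -/
def Ray.Equivalent (R S : G.Ray) : Prop := ∀ X : Finset V, ¬ R.SeparatedBy S X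

theorem Ray.exists_avoids (R : G.Ray) (X : Finset V) :
    ∃ N, ∀ n, N ≤ n → R.vert n ∉ (X : Set V) := by
  have hf : (R.vert ⁻¹' (X : Set V)).Finite := X.finite_toSet.preimage R.inj.injOn
  obtain ⟨N, hN⟩ := hf.bddAbove
  exact ⟨N + 1, fun n hn h => by have := hN h; omega⟩

/-- An index from which on the ray avoids `X`. -/
def Ray.idx (R : G.Ray) (X : Finset V) : ℕ := (R.exists_avoids X).choose

theorem Ray.notMem_of_idx_le (R : G.Ray) (X : Finset V) {n : ℕ} (h : R.idx X ≤ n) :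
    R.vert n ∉ (X : Set V) := (R.exists_avoids X).choose_spec n h

/-- The component of `G - X` that contains a tail of the ray. -/
def Ray.comp (R : G.Ray) (X : Finset V) : G.ComponentCompl (X : Set V) :=
  G.componentComplMk (R.notMem_of_idx_le X le_rfl)

theorem Ray.mk_eq_comp (R : G.Ray) (X : Finset V) {n : ℕ} (h : R.idx X ≤ n) :
    G.componentComplMk (R.notMem_of_idx_le X h) = R.comp X := by
  induction n, h using Nat.le_induction with
  | base => rfl
  | succ n hn ih =>
    rw [← ih]
    exact (componentComplMk_eq_of_adj G _ _ (R.adj n)).symm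

theorem Ray.comp_hasTailIn (R : G.Ray) (X : Finset V) : R.HasTailIn (R.comp X : Set V) :=
  ⟨R.idx X, fun n hn => ⟨R.notMem_of_idx_le X hn, R.mk_eq_comp X hn⟩⟩

/-- Rays are equivalent iff for every finite `X` they have tails in the same component of
`G - X`. -/
theorem Ray.equivalent_iff (R S : G.Ray) : R.Equivalent S ↔ ∀ X : Finset V, R.comp X = S.comp X := by
  classical
  constructor
  · intro h X
    let A := (Finset.range (R.idx X)).image R.vert
    let B := (Finset.range (S.idx X)).image S.vert
    have h' := h (X ∪ A ∪ B)
    simp only [Ray.SeparatedBy, not_forall, not_not] at h'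
    obtain ⟨m, n, hm, hn, e⟩ := h'
    have hX : (X : Set V) ⊆ ((X ∪ A ∪ B : Finset V) : Set V) := by
      intro x hx; simp only [Finset.mem_coe, Finset.mem_union] at hx ⊢; exact Or.inl (Or.inl hx)
    have hm' : R.idx X ≤ m := by
      by_contra hlt
      apply hm
      simp only [Finset.mem_coe, Finset.mem_union]
      exact Or.inl (Or.inr (Finset.mem_image.2 ⟨m, Finset.mem_range.2 (by omega), rfl⟩))
    have hn' : S.idx X ≤ n := by
      by_contra hlt
      apply hn
      simp only [Finset.mem_coe, Finset.mem_union]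
      exact Or.inr (Finset.mem_image.2 ⟨n, Finset.mem_range.2 (by omega), rfl⟩)
    rw [← R.mk_eq_comp X hm', ← S.mk_eq_comp X hn']
    exact congrArg (ComponentCompl.hom hX) e
  · intro h X hs
    exact hs _ _ _ _ (h X)

instance raySetoid (G : SimpleGraph V) : Setoid G.Ray where
  r := Ray.Equivalent
  iseqv :=
    { refl := fun R => (R.equivalent_iff R).2 fun _ => rfl
      symm := fun {R S} h => (S.equivalent_iff R).2 fun X => ((R.equivalent_iff S).1 h X).symm
      trans := fun {R S T} h h' => (R.equivalent_iff T).2 fun X =>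
        ((R.equivalent_iff S).1 h X).trans ((S.equivalent_iff T).1 h' X) }

/-- The ends of `G`: the equivalence classes of rays. -/
def RayEnd (G : SimpleGraph V) : Type u := Quotient (raySetoid G)

/-- The end that contains the ray `R`. -/
def Ray.toEnd (R : G.Ray) : G.RayEnd := Quotient.mk (raySetoid G) R

/-- `C(X, ω)`, the component of `G - X` that contains a tail of every ray in `ω`. -/
def RayEnd.comp (ω : G.RayEnd) (X : Finset V) : G.ComponentCompl (X : Set V) :=
  Quotient.lift (fun R : G.Ray => R.comp X) (fun R S h => (R.equivalent_iff S).1 h X) ω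

/-- The end space: its basic open sets are the sets `Ω(X, C)` of all ends living in `C`, where `X`
is a finite vertex set and `C` a component of `G - X`. -/
instance (G : SimpleGraph V) : TopologicalSpace G.RayEnd :=
  TopologicalSpace.generateFrom
    {U | ∃ (X : Finset V) (C : G.ComponentCompl (X : Set V)), U = {ω : G.RayEnd | ω.comp X = C}}

/-! ### Directions -/

/-- A direction of `G`: a map assigning to every finite vertex set `X` a component of `G - X`, such
that the component of `X` contains that of `Y` whenever `X ⊆ Y`. (Mathlib calls these the ends of
`G`.) -/
abbrev Direction (G : SimpleGraph V) : Type u := G.end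

/-- The component `f(X)` of `G - X`. -/
def Direction.comp (f : G.Direction) (X : Finset V) : G.ComponentCompl (X : Set V) :=
  f.1 (Opposite.op X)

theorem Direction.comp_anti (f : G.Direction) {X Y : Finset V} (h : X ⊆ Y) :
    (f.comp Y : Set V) ⊆ (f.comp X : Set V) :=
  (ComponentCompl.hom_eq_iff_le (f.comp Y) (Finset.coe_subset.2 h) (f.comp X)).1
    (f.2 (CategoryTheory.opHomOfLE h))

/-- The direction `f_ω` defined by an end `ω`. -/
def RayEnd.direction (ω : G.RayEnd) : G.Direction :=
  ⟨fun X => ω.comp X.unop, by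
    intro X Y i
    induction ω using Quotient.inductionOn with
    | h R =>
      have h : ((Y.unop : Finset V) : Set V) ⊆ ((X.unop : Finset V) : Set V) :=
        Finset.coe_subset.2 (CategoryTheory.leOfHom i.unop)
      let n := max (R.idx X.unop) (R.idx Y.unop)
      change (R.comp X.unop).hom h = R.comp Y.unop
      rw [← R.mk_eq_comp X.unop (le_max_left _ _ : _ ≤ n),
        ← R.mk_eq_comp Y.unop (le_max_right _ _ : _ ≤ n)]
      rfl⟩

/-- A countable set of directional choices `(X, C)` distinguishes `f` from every other
direction. -/
def Direction.CountablyDetermined (f : G.Direction) : Prop :=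
  ∃ S : Set (Σ X : Finset V, G.ComponentCompl (X : Set V)), S.Countable ∧
    ∀ h : G.Direction, h ≠ f → ∃ p ∈ S, f.comp p.1 = p.2 ∧ h.comp p.1 ≠ p.2

/-! ### Domination -/

/-- The vertex `v` dominates the ray `R`: there are infinitely many `v`–`(R - v)` paths that have
pairwise only the vertex `v` in common. -/
def DominatesRay (v : V) (R : G.Ray) : Prop :=
  ∃ (w : ℕ → V) (p : ∀ k, G.Walk v (w k)),
    (∀ k, (p k).IsPath ∧ w k ≠ v ∧ w k ∈ R.verts ∧
      ∀ x ∈ (p k).support, x ∈ R.verts → x = v ∨ x = w k) ∧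
    ∀ k l, k ≠ l → ∀ x, x ∈ (p k).support → x ∈ (p l).support → x = v

/-- The vertex `v` dominates the end `ω`. -/
def Dominates (v : V) (ω : G.RayEnd) : Prop :=
  ∃ R : G.Ray, R.toEnd = ω ∧ DominatesRay v R

/-! ### Generalised paths, generalised stars and suns -/

/-- The possible underlying graphs of a generalised path: double rays, finite paths and rays. -/
inductive PathLike (G : SimpleGraph V) : Type u
  | double (D : G.DoubleRay)
  | finite {a b : V} (p : G.Path a b)
  | ray (R : G.Ray)

/-- The vertex set of the underlying graph. -/
def PathLike.verts : G.PathLike → Set V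
  | .double D => D.verts
  | .finite p => {x | x ∈ p.1.support}
  | .ray R => R.verts

/-- `(P, {ω₁, ω₂})` is a generalised path. As the set of endpoints is unordered, either
endpoint may play either role. -/
def IsGeneralisedPath (P : G.PathLike) (ω₁ ω₂ : G.RayEnd) : Prop :=
  ω₁ ≠ ω₂ ∧
    match P with
    | .double D =>
        (D.bwd.toEnd = ω₁ ∧ D.fwd.toEnd = ω₂) ∨ (D.bwd.toEnd = ω₂ ∧ D.fwd.toEnd = ω₁)
    | .finite (a := a) (b := b) _ =>
        (Dominates a ω₁ ∧ Dominates b ω₂) ∨ (Dominates a ω₂ ∧ Dominates b ω₁)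
    | .ray R =>
        (R.toEnd = ω₁ ∧ Dominates (R.vert 0) ω₂) ∨ (R.toEnd = ω₂ ∧ Dominates (R.vert 0) ω₁)

/-- A generalised star with centre `ω`, generalised paths `(P i, {ω, leaf i})` and leaves
`leaf i`. -/
structure IsGeneralisedStar {I : Type u} (ω : G.RayEnd) (P : I → G.PathLike)
    (leaf : I → G.RayEnd) : Prop where
  isGeneralisedPath : ∀ i, IsGeneralisedPath (P i) ω (leaf i)
  disjoint : ∀ i j, i ≠ j → Disjoint (P i).verts (P j).verts
  leaf_injective : Function.Injective leaf

/-- A sun with centre `ω`: a proper generalised star, i.e. one where either every `P i` is a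
double ray, or every `P i` is a ray in `leaf i` whose first vertex dominates `ω`. -/
structure IsSun {I : Type u} (ω : G.RayEnd) (P : I → G.PathLike) (leaf : I → G.RayEnd) : Prop
    extends IsGeneralisedStar ω P leaf where
  proper : (∀ i, ∃ D : G.DoubleRay, P i = .double D) ∨
    (∀ i, ∃ R : G.Ray, P i = .ray R ∧ R.toEnd = leaf i ∧ Dominates (R.vert 0) ω)

/-- There is an uncountable sun in `G` centred at `ω`. -/
def HasUncountableSun (ω : G.RayEnd) : Prop :=
  ∃ (I : Type u) (P : I → G.PathLike) (leaf : I → G.RayEnd), Uncountable I ∧ IsSun ω P leaf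

/-- Some tail of the ray, or some tail of the double ray, lies in `A`. -/
def PathLike.HasTailIn : G.PathLike → Set V → Prop
  | .double D, A => D.bwd.HasTailIn A ∨ D.fwd.HasTailIn A
  | .finite _, _ => False
  | .ray R, A => R.HasTailIn A

/-- `G` contains uncountably many disjoint pairwise inequivalent rays, all of which start at
vertices that dominate `ω`. -/
def HasUncountablyManyDominatingRays (ω : G.RayEnd) : Prop :=
  ∃ (I : Type u) (R : I → G.Ray), Uncountable I ∧
    (∀ i j, i ≠ j → Disjoint (R i).verts (R j).verts) ∧
    (∀ i j, i ≠ j → ¬ (R i).Equivalent (R j)) ∧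
    ∀ i, Dominates ((R i).vert 0) ω

/-- `G` contains uncountably many disjoint double rays, all having one tail in `ω` and another not
in `ω`, so that the latter tails are inequivalent for distinct double rays. (The double rays are
directed so that the former tails are the backward ones.) -/
def HasUncountablyManyDoubleRays (ω : G.RayEnd) : Prop :=
  ∃ (I : Type u) (D : I → G.DoubleRay), Uncountable I ∧
    (∀ i j, i ≠ j → Disjoint (D i).verts (D j).verts) ∧
    (∀ i, (D i).bwd.toEnd = ω ∧ (D i).fwd.toEnd ≠ ω) ∧
    ∀ i j, i ≠ j → ¬ (D i).fwd.Equivalent (D j).fwd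

/-! ### Tree-decompositions -/

/-- `(T, 𝒱)` is a tree-decomposition of `G`. -/
structure IsTreeDecomposition {W : Type u} (G : SimpleGraph V) (T : SimpleGraph W)
    (𝒱 : W → Set V) : Prop where
  isTree : T.IsTree
  cover : ⋃ t, 𝒱 t = Set.univ
  edge : ∀ x y, G.Adj x y → ∃ t, x ∈ 𝒱 t ∧ y ∈ 𝒱 t
  between : ∀ (t₁ t₂ t₃ : W) (p : T.Walk t₁ t₃), p.IsPath → t₂ ∈ p.support →
    𝒱 t₁ ∩ 𝒱 t₃ ⊆ 𝒱 t₂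

/-- All adhesion sets are finite. -/
def FiniteAdhesion {W : Type u} (T : SimpleGraph W) (𝒱 : W → Set V) : Prop :=
  ∀ t₁ t₂, T.Adj t₁ t₂ → (𝒱 t₁ ∩ 𝒱 t₂).Finite

/-- The end `ω` lives in the part `A` of a tree-decomposition: every ray in `ω` has infinitely many
vertices in `A`. -/
def RayEnd.LivesIn (ω : G.RayEnd) (A : Set V) : Prop :=
  ∀ R : G.Ray, R.toEnd = ω → (R.verts ∩ A).Infinite

/-- `𝒱` is a star-decomposition of finite adhesion of `G`, whose decomposition tree is the star
with centre `none` and leaves `some i`, where `i` ranges over `I`. -/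
def IsStarDecompositionOfFiniteAdhesion {I : Type u} (G : SimpleGraph V) (𝒱 : Option I → Set V) : Prop :=
  IsTreeDecomposition G (starGraph (none : Option I)) 𝒱 ∧
    FiniteAdhesion (starGraph (none : Option I)) 𝒱

end SimpleGraph

end

noncomputable section

namespace SimpleGraph

variable {V : Type u} {G : SimpleGraph V}

/-! ### Connected sets of vertices -/

/-- The vertices `x` and `y` are joined by a walk inside `A`. -/
def Joined (G : SimpleGraph V) (A : Set V) (x y : V) : Prop :=
  ∃ p : G.Walk x y, ∀ z ∈ p.support, z ∈ A

theorem Joined.refl {A : Set V} {x : V} (hx : x ∈ A) : G.Joined A x x :=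
  ⟨.nil, by simpa using hx⟩

theorem Joined.symm {A : Set V} {x y : V} (h : G.Joined A x y) : G.Joined A y x := by
  obtain ⟨p, hp⟩ := h
  exact ⟨p.reverse, by simpa using hp⟩

theorem Joined.trans {A : Set V} {x y z : V} (h : G.Joined A x y) (h' : G.Joined A y z) :
    G.Joined A x z := by
  obtain ⟨p, hp⟩ := h
  obtain ⟨q, hq⟩ := h'
  refine ⟨p.append q, fun w hw => ?_⟩
  rcases (Walk.mem_support_append_iff _ _).1 hw with h | h
  exacts [hp w h, hq w h]

theorem Joined.mono {A B : Set V} (hAB : A ⊆ B) {x y : V} (h : G.Joined A x y) :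
    G.Joined B x y := by
  obtain ⟨p, hp⟩ := h
  exact ⟨p, fun z hz => hAB (hp z hz)⟩

theorem Joined.left_mem {A : Set V} {x y : V} (h : G.Joined A x y) : x ∈ A := by
  obtain ⟨p, hp⟩ := h
  exact hp x p.start_mem_support

theorem Joined.right_mem {A : Set V} {x y : V} (h : G.Joined A x y) : y ∈ A := h.symm.left_mem

theorem Joined.of_adj {A : Set V} {x y : V} (h : G.Adj x y) (hx : x ∈ A) (hy : y ∈ A) :
    G.Joined A x y :=
  ⟨h.toWalk, by simp [hx, hy]⟩

/-- A set that contains `x` and is closed under passing to neighbours in `A` contains everything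
joined to `x` in `A`. -/
theorem Joined.mem_of_closed {A B : Set V} {x y : V} (h : G.Joined A x y) (hx : x ∈ B)
    (hB : ∀ a b, a ∈ B → a ∈ A → b ∈ A → G.Adj a b → b ∈ B) : y ∈ B := by
  obtain ⟨p, hp⟩ := h
  induction p with
  | nil => exact hx
  | cons hadj p ih =>
    simp only [Walk.support_cons, List.mem_cons, forall_eq_or_imp] at hp
    exact ih (hB _ _ hx hp.1 (hp.2 _ p.start_mem_support) hadj) hp.2

/-- A walk in `A` leaving `B` passes an edge leaving `B`. -/
theorem Joined.exists_adj_leaving {A B : Set V} {x y : V} (h : G.Joined A x y) (hx : x ∈ B)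
    (hy : y ∉ B) : ∃ a b, a ∈ B ∧ a ∈ A ∧ b ∈ A ∧ b ∉ B ∧ G.Adj a b := by
  by_contra hcon
  push Not at hcon
  exact hy (h.mem_of_closed hx fun a b ha ha' hb hab => by
    by_contra hb'
    exact hcon a b ha ha' hb hb' hab)

theorem Walk.exists_first_hit {x y : V} (p : G.Walk x y) {B : Set V} (hy : y ∈ B) :
    ∃ b ∈ B, ∃ q : G.Walk x b, (∀ z ∈ q.support, z ∈ p.support) ∧
      ∀ z ∈ q.support, z ∈ B → z = b := by
  induction p with
  | nil => exact ⟨_, hy, .nil, by simp, by simp⟩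
  | @cons u v w hadj p ih =>
    by_cases hu : u ∈ B
    · exact ⟨u, hu, .nil, by simp, by simp⟩
    · obtain ⟨b, hb, q, hq, hq'⟩ := ih hy
      refine ⟨b, hb, .cons hadj q, ?_, ?_⟩
      · intro z hz
        simp only [Walk.support_cons, List.mem_cons] at hz ⊢
        exact hz.imp_right (hq z)
      · intro z hz hzB
        simp only [Walk.support_cons, List.mem_cons] at hz
        rcases hz with rfl | hz
        · exact absurd hzB hu
        · exact hq' z hz hzB

/-- If `x` is joined in `A` to a vertex of `B`, then there is a path in `A` from `x` that meets `B`
precisely in its last vertex. -/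
theorem Joined.exists_path_to {A B : Set V} {x y : V} (h : G.Joined A x y) (hy : y ∈ B) :
    ∃ b ∈ B, ∃ q : G.Walk x b, q.IsPath ∧ (∀ z ∈ q.support, z ∈ A) ∧
      ∀ z ∈ q.support, z ∈ B → z = b := by
  classical
  obtain ⟨p, hp⟩ := h
  obtain ⟨b, hb, q, hq, hq'⟩ := p.exists_first_hit hy
  exact ⟨b, hb, q.bypass, q.bypass_isPath, fun z hz => hp z (hq z (q.support_bypass_subset_support hz)),
    fun z hz => hq' z (q.support_bypass_subset_support hz)⟩

/-- Any two vertices of `A` are joined inside `A`. -/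
def ConnectedSet (G : SimpleGraph V) (A : Set V) : Prop :=
  ∀ x ∈ A, ∀ y ∈ A, G.Joined A x y

theorem Joined.component {A : Set V} {x y : V} (h : G.Joined A x y) :
    G.Joined {z | G.Joined A x z} x y := by
  classical
  obtain ⟨p, hp⟩ := h
  exact ⟨p, fun z hz => ⟨p.takeUntil z hz, fun w hw => hp w (p.support_takeUntil_subset_support hz hw)⟩⟩

theorem connectedSet_component (A : Set V) (x : V) : G.ConnectedSet {z | G.Joined A x z} :=
  fun _ hy _ hz => (Joined.component hy).symm.trans (Joined.component hz)

/-! ### Components of the complement of a set -/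

theorem Walk.joined_of_induce {A : Set V} {x y : A} (p : (G.induce A).Walk x y) :
    G.Joined A x y := by
  induction p with
  | nil => exact .refl (Subtype.prop _)
  | cons h _ ih => exact (Joined.of_adj (G := G) (induce_adj.1 h) (Subtype.prop _) (Subtype.prop _)).trans ih

namespace ComponentCompl

variable {X : Set V}

theorem joined_of_mem {C : G.ComponentCompl X} {x y : V} (hx : x ∈ C) (hy : y ∈ C) :
    G.Joined Xᶜ x y := by
  obtain ⟨hx, rfl⟩ := hx
  obtain ⟨hy, e⟩ := hy
  obtain ⟨p⟩ := ConnectedComponent.exact e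
  exact p.joined_of_induce.symm

theorem mem_of_joined {C : G.ComponentCompl X} {x y : V} (hx : x ∈ C) (h : G.Joined Xᶜ x y) :
    y ∈ C :=
  h.mem_of_closed (B := (C : Set V)) hx fun a b ha _ hb hab => mem_of_adj a b ha hb hab

theorem connectedSet (C : G.ComponentCompl X) : G.ConnectedSet (C : Set V) := by
  intro x hx y hy
  obtain ⟨p, hp⟩ := (joined_of_mem hx hy).component
  exact ⟨p, fun z hz => mem_of_joined hx (hp z hz)⟩

/-- A connected set avoiding `X` that meets a component of `G - X` lies in it. -/
theorem subset_of_connectedSet {C : G.ComponentCompl X} {A : Set V} (hA : G.ConnectedSet A)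
    (hAX : Disjoint A X) {x : V} (hxA : x ∈ A) (hxC : x ∈ C) : A ⊆ C :=
  fun y hy => mem_of_joined hxC ((hA x hxA y hy).mono (Set.disjoint_left.1 hAX))

theorem eq_of_mem {C D : G.ComponentCompl X} {x : V} (hC : x ∈ C) (hD : x ∈ D) : C = D := by
  obtain ⟨h, rfl⟩ := hC
  obtain ⟨h', rfl⟩ := hD
  rfl

end ComponentCompl

/-! ### Rays and components -/

theorem Ray.joined (R : G.Ray) {A : Set V} {m n : ℕ} (hmn : m ≤ n)
    (h : ∀ k, m ≤ k → k ≤ n → R.vert k ∈ A) : G.Joined A (R.vert m) (R.vert n) := by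
  induction n, hmn using Nat.le_induction with
  | base => exact .refl (h _ le_rfl le_rfl)
  | succ n hn ih =>
    exact (ih fun k h1 h2 => h k h1 (by omega)).trans
      (.of_adj (R.adj n) (h n hn (by omega)) (h _ (by omega) le_rfl))

theorem Ray.vert_mem_comp (R : G.Ray) (X : Finset V) {n : ℕ} (hn : R.idx X ≤ n) :
    R.vert n ∈ R.comp X :=
  ⟨R.notMem_of_idx_le X hn, R.mk_eq_comp X hn⟩

theorem Ray.comp_eq_of_frequently (R : G.Ray) {X : Finset V} {C : G.ComponentCompl (X : Set V)}
    (h : ∀ N, ∃ n, N ≤ n ∧ R.vert n ∈ C) : R.comp X = C := by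
  obtain ⟨n, hn, hC⟩ := h (R.idx X)
  exact ComponentCompl.eq_of_mem (R.vert_mem_comp X hn) hC

/-- A ray that avoids `X` lies in the component containing its tails. -/
theorem Ray.vert_mem_comp_of_avoids (R : G.Ray) {X : Finset V} {m : ℕ}
    (h : ∀ n, m ≤ n → R.vert n ∉ X) : R.vert m ∈ R.comp X := by
  have hn := R.vert_mem_comp X (le_max_right m (R.idx X))
  exact ComponentCompl.mem_of_joined hn
    (R.joined (A := (X : Set V)ᶜ) (le_max_left _ _) fun k hk _ => h k hk).symm

theorem RayEnd.exists_ray (ω : G.RayEnd) : ∃ R : G.Ray, R.toEnd = ω := Quotient.exists_rep ω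

theorem Ray.toEnd_comp (R : G.Ray) (X : Finset V) : R.toEnd.comp X = R.comp X := rfl

theorem Ray.toEnd_eq_iff {R S : G.Ray} : R.toEnd = S.toEnd ↔ ∀ X, R.comp X = S.comp X := by
  rw [← Ray.equivalent_iff]
  exact Quotient.eq (r := raySetoid G)

theorem RayEnd.ext_comp {ω ω' : G.RayEnd} (h : ∀ X, ω.comp X = ω'.comp X) : ω = ω' := by
  obtain ⟨R, rfl⟩ := ω.exists_ray
  obtain ⟨S, rfl⟩ := ω'.exists_ray
  exact Ray.toEnd_eq_iff.2 h

theorem RayEnd.exists_comp_ne {ω ω' : G.RayEnd} (h : ω ≠ ω') : ∃ X, ω.comp X ≠ ω'.comp X := by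
  by_contra hcon
  push Not at hcon
  exact h (RayEnd.ext_comp hcon)

theorem RayEnd.direction_comp (ω : G.RayEnd) (X : Finset V) : ω.direction.comp X = ω.comp X := rfl

theorem Direction.ext_comp {f g : G.Direction} (h : ∀ X, f.comp X = g.comp X) : f = g :=
  Subtype.ext (funext fun X => h X.unop)

theorem RayEnd.comp_anti (ω : G.RayEnd) {X Y : Finset V} (h : X ⊆ Y) :
    (ω.comp Y : Set V) ⊆ (ω.comp X : Set V) :=
  ω.direction.comp_anti h

theorem RayEnd.direction_injective :
    Function.Injective (RayEnd.direction : G.RayEnd → G.Direction) := fun ω ω' h =>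
  RayEnd.ext_comp fun X => by rw [← ω.direction_comp, h, ω'.direction_comp]

/-! ### Constructing rays -/

theorem Walk.IsPath.append_of_inter {u v w : V} {p : G.Walk u v} {q : G.Walk v w} (hp : p.IsPath)
    (hq : q.IsPath) (h : ∀ z ∈ p.support, z ∈ q.support → z = v) : (p.append q).IsPath := by
  rw [Walk.isPath_def, Walk.support_append, List.nodup_append']
  have hq' := (Walk.isPath_def _).1 hq
  rw [← Walk.cons_tail_support] at hq'
  refine ⟨(Walk.isPath_def _).1 hp, (List.nodup_cons.1 hq').2, fun z hz hz' => ?_⟩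
  have := h z hz (List.mem_of_mem_tail hz')
  subst this
  exact (List.nodup_cons.1 hq').1 hz'

/-- An infinite sequence of paths, each properly extending the previous one, defines a ray. -/
theorem exists_ray_of_extending_paths {a : V} (x : ℕ → V) (q : ∀ n, G.Walk a (x n))
    (p : ∀ n, G.Walk (x n) (x (n + 1))) (hq : ∀ n, q (n + 1) = (q n).append (p n))
    (hpath : ∀ n, (q n).IsPath) (hne : ∀ n, x n ≠ x (n + 1)) :
    ∃ R : G.Ray, R.vert 0 = a ∧ (∀ n, R.vert (q n).length = x n) ∧
      ∀ n k, (q n).length ≤ k → ∃ m, n ≤ m ∧ R.vert k ∈ (p m).support := by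
  have hlen : ∀ n, (q n).length < (q (n + 1)).length := by
    intro n
    rw [hq, Walk.length_append]
    have : (p n).length ≠ 0 := fun h => hne n (Walk.eq_of_length_eq_zero h)
    omega
  have hlen' : ∀ n, n ≤ (q n).length := by
    intro n
    induction n with
    | zero => omega
    | succ n ih => have := hlen n; omega
  have hstab : ∀ n m k, n ≤ m → k ≤ (q n).length →
      k ≤ (q m).length ∧ (q m).getVert k = (q n).getVert k := by
    intro n m k hnm hk
    induction m, hnm using Nat.le_induction with
    | base => exact ⟨hk, rfl⟩
    | succ m _ ih =>
      refine ⟨by have := hlen m; omega, ?_⟩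
      rw [hq, Walk.getVert_append', if_pos ih.1, ih.2]
  have hvert : ∀ n k, k ≤ (q n).length → (q k).getVert k = (q n).getVert k := by
    intro n k hk
    rw [← (hstab n (max n k) k (le_max_left _ _) hk).2,
      ← (hstab k (max n k) k (le_max_right _ _) (hlen' k)).2]
  refine ⟨⟨fun k => (q k).getVert k, ?_, ?_⟩, ?_, ?_, ?_⟩
  · intro k l hkl
    have h1 := hvert (max k l) k ((le_max_left _ _).trans (hlen' _))
    have h2 := hvert (max k l) l ((le_max_right _ _).trans (hlen' _))
    refine (hpath (max k l)).getVert_injOn ((le_max_left _ _).trans (hlen' _))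
      ((le_max_right _ _).trans (hlen' _)) ?_
    rw [← h1, ← h2]
    exact hkl
  · intro k
    have := hvert (k + 1) k ((Nat.le_succ k).trans (hlen' _))
    rw [this]
    exact Walk.adj_getVert_succ _ (hlen' (k + 1))
  · exact Walk.getVert_zero _
  · intro n
    change (q _).getVert _ = _
    rw [hvert n _ le_rfl, Walk.getVert_length]
  · intro n k hk
    have key : ∀ m, n ≤ m → k < (q m).length →
        ∃ m, n ≤ m ∧ (q k).getVert k ∈ (p m).support := by
      intro m hm
      induction m, hm using Nat.le_induction with
      | base => intro h; omega
      | succ m hm ih =>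
        intro h
        by_cases hkm : k < (q m).length
        · exact ih hkm
        · refine ⟨m, hm, ?_⟩
          rw [hvert (m + 1) k h.le, hq, Walk.getVert_append, if_neg hkm]
          exact Walk.getVert_mem_support _ _
    exact key (max n (k + 1)) (le_max_left _ _)
      ((le_max_right _ _).trans (hlen' _))

/-- The data of a path from `a` that is to be extended. -/
structure PathFrom (G : SimpleGraph V) (a : V) where
  last : V
  walk : G.Walk a last
  isPath : walk.IsPath

/-- A decreasing sequence of connected sets with empty intersection contains a ray that has a tail
in each of them. -/
theorem exists_ray_of_nested_connectedSets (L : ℕ → Set V) (hanti : Antitone L)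
    (hne : ∀ n, (L n).Nonempty) (hconn : ∀ n, G.ConnectedSet (L n)) (hinter : ∀ x, ∃ n, x ∉ L n) :
    ∃ R : G.Ray, R.verts ⊆ L 0 ∧ ∀ n, R.HasTailIn (L n) := by
  obtain ⟨a, ha⟩ := hne 0
  let σ := {s : ℕ × PathFrom G a // s.2.last ∈ L s.1 ∧
    ∀ z ∈ s.2.walk.support, z ∈ L s.1 → z = s.2.last}
  have step : ∀ s : σ, ∃ (s' : σ) (p : G.Walk s.1.2.last s'.1.2.last), s.1.1 < s'.1.1 ∧
      (∀ z ∈ p.support, z ∈ L s.1.1) ∧ s'.1.2.walk = s.1.2.walk.append p ∧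
      s.1.2.last ≠ s'.1.2.last := by
    rintro ⟨⟨n, x, q, hq⟩, hx, hqL⟩
    simp only at hx hqL
    choose N hN using hinter
    obtain ⟨m, hnm, hm⟩ : ∃ m, n < m ∧ ∀ z ∈ q.support, z ∉ L m := by
      classical
      refine ⟨max (n + 1) (q.support.toFinset.sup N),
        (Nat.lt_succ_self n).trans_le (le_max_left _ _), fun z hz hzL => hN z ?_⟩
      exact hanti ((Finset.le_sup (f := N) (List.mem_toFinset.2 hz)).trans (le_max_right _ _)) hzL
    obtain ⟨y, hy⟩ := hne m
    obtain ⟨b, hb, p, hp, hpn, hpm⟩ :=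
      (hconn n x hx y (hanti hnm.le hy)).exists_path_to hy
    refine ⟨⟨⟨m, b, q.append p, hq.append_of_inter hp fun z hz hz' => hqL z hz (hpn z hz')⟩,
      hb, ?_⟩, p, hnm, hpn, rfl, ?_⟩
    · intro z hz hzL
      rcases (Walk.mem_support_append_iff _ _).1 hz with h | h
      · exact absurd hzL (hm z h)
      · exact hpm z h hzL
    · rintro rfl
      exact hm _ q.end_mem_support hb
  choose next p hlt hpL hwalk hnelast using step
  let s : ℕ → σ := fun n => n.rec ⟨⟨0, a, .nil, .nil⟩, ha, by simp⟩ fun _ t => next t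
  have hs : ∀ n, n ≤ (s n).1.1 := by
    intro n
    induction n with
    | zero => exact Nat.zero_le _
    | succ n ih => exact (Nat.succ_le_succ ih).trans (hlt (s n))
  obtain ⟨R, -, -, hR⟩ := exists_ray_of_extending_paths (fun n => (s n).1.2.last)
    (fun n => (s n).1.2.walk) (fun n => p (s n)) (fun n => hwalk (s n))
    (fun n => (s n).1.2.isPath) (fun n => hnelast (s n))
  have htail : ∀ n, R.HasTailIn (L n) := by
    refine fun n => ⟨(s n).1.2.walk.length, fun k hk => ?_⟩
    obtain ⟨m, hm, hk⟩ := hR n k hk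
    exact hanti (hm.trans (hs m)) (hpL _ _ hk)
  refine ⟨R, ?_, htail⟩
  rintro _ ⟨k, rfl⟩
  obtain ⟨m, hm, hk⟩ := hR 0 k (Nat.zero_le _)
  exact hanti (Nat.zero_le _) (hpL _ _ hk)

/-- An infinite set of vertices no two of which can be separated by a finite set of other vertices
meets some ray infinitely often. -/
theorem exists_ray_of_infinite_inseparable {U : Set V} (hU : U.Infinite)
    (h : ∀ X : Finset V, ∀ u ∈ U, ∀ v ∈ U, u ∉ X → v ∉ X → G.Joined (X : Set V)ᶜ u v) :
    ∃ R : G.Ray, ∀ F : Finset V, ∀ N, ∃ n, N ≤ n ∧ R.vert n ∈ U \ F := by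
  classical
  obtain ⟨a, ha⟩ := hU.nonempty
  let σ := {s : PathFrom G a // s.last ∈ U}
  have step : ∀ s : σ, ∃ (s' : σ) (p : G.Walk s.1.last s'.1.last),
      s'.1.walk = s.1.walk.append p ∧ s.1.last ≠ s'.1.last := by
    rintro ⟨⟨x, q, hq⟩, hx⟩
    simp only at hx
    obtain ⟨y, hyU, hy⟩ := hU.exists_notMem_finset q.support.toFinset
    rw [List.mem_toFinset] at hy
    obtain ⟨b, rfl, p, hp, hpX, -⟩ := (h (q.support.toFinset.erase x) x hx y hyU (by simp)
      (by simp [hy])).exists_path_to (Set.mem_singleton y)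
    refine ⟨⟨⟨b, q.append p, hq.append_of_inter hp fun z hz hz' => ?_⟩, hyU⟩, p, rfl, ?_⟩
    · by_contra hzx
      exact hpX z hz' (by simp [hzx, hz])
    · rintro rfl
      exact hy q.end_mem_support
  choose next p hwalk hnelast using step
  let s : ℕ → σ := fun n => n.rec ⟨⟨a, .nil, .nil⟩, ha⟩ fun _ t => next t
  obtain ⟨R, -, hR, -⟩ := exists_ray_of_extending_paths (fun n => (s n).1.last)
    (fun n => (s n).1.walk) (fun n => p (s n)) (fun n => hwalk (s n))
    (fun n => (s n).1.isPath) (fun n => hnelast (s n))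
  have hlen : ∀ n, n ≤ (s n).1.walk.length := by
    intro n
    induction n with
    | zero => exact Nat.zero_le _
    | succ n ih =>
      have h1 : (s (n + 1)).1.walk = (s n).1.walk.append (p (s n)) := hwalk (s n)
      have h2 : (p (s n)).length ≠ 0 := fun h => hnelast (s n) (Walk.eq_of_length_eq_zero h)
      rw [h1, Walk.length_append]
      omega
  refine ⟨R, fun F N => ?_⟩
  obtain ⟨M, hM⟩ := R.exists_avoids F
  refine ⟨(s (max M N)).1.walk.length, (le_max_right M N).trans (hlen _), ?_, ?_⟩
  · rw [hR]
    exact (s (max M N)).2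
  · exact hM _ ((le_max_left M N).trans (hlen _))

theorem Ray.toEnd_eq_of_shift {R S : G.Ray} {i m : ℕ}
    (h : ∀ k, R.vert (i + k) = S.vert (m + k)) : R.toEnd = S.toEnd := by
  refine Ray.toEnd_eq_iff.2 fun X => R.comp_eq_of_frequently fun N => ?_
  refine ⟨i + (N + S.idx X), by omega, ?_⟩
  rw [h]
  exact S.vert_mem_comp X (by omega)

/-- The tail of a ray starting at its `m`-th vertex. -/
def Ray.drop (R : G.Ray) (m : ℕ) : G.Ray where
  vert n := R.vert (m + n)
  inj _ _ h := by simpa using R.inj h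
  adj n := R.adj (m + n)

theorem Ray.toEnd_drop (R : G.Ray) (m : ℕ) : (R.drop m).toEnd = R.toEnd :=
  Ray.toEnd_eq_of_shift (i := 0) (m := m) fun k => by simp [Ray.drop]

/-- In a connected set, every vertex is the first vertex of a ray that shares a tail with a given
ray. -/
theorem Ray.exists_ray_from (R : G.Ray) {K : Set V} (hK : G.ConnectedSet K) (hRK : R.verts ⊆ K)
    {v : V} (hv : v ∈ K) : ∃ S : G.Ray, S.vert 0 = v ∧ S.verts ⊆ K ∧
      ∃ i m, ∀ k, S.vert (i + k) = R.vert (m + k) := by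
  obtain ⟨b, ⟨m, rfl⟩, p, hp, hpK, hpR⟩ :=
    (hK v hv (R.vert 0) (hRK ⟨0, rfl⟩)).exists_path_to (B := R.verts) ⟨0, rfl⟩
  let g : ℕ → V := fun k => if k < p.length then p.getVert k else R.vert (m + (k - p.length))
  have hg : ∀ k, k ≤ p.length → g k = p.getVert k := by
    intro k hk
    by_cases h : k < p.length
    · simp [g, h]
    · have : k = p.length := by omega
      simp [g, this]
  have hg' : ∀ k, g (p.length + k) = R.vert (m + k) := by
    intro k
    simp [g]
  have hgR : ∀ k l, k < p.length → g k ≠ g (p.length + l) := by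
    intro k l hk e
    rw [hg k hk.le, hg'] at e
    have h1 := hpR _ (p.getVert_mem_support k) ⟨m + l, e.symm⟩
    have h2 := hp.getVert_injOn (Set.mem_ofPred.2 hk.le) (Set.mem_ofPred.2 le_rfl)
      (h1.trans p.getVert_length.symm)
    omega
  refine ⟨⟨g, ?_, ?_⟩, ?_, ?_, p.length, m, hg'⟩
  · intro k l e
    rcases lt_or_ge k p.length with hk | hk <;> rcases lt_or_ge l p.length with hl | hl
    · rw [hg k hk.le, hg l hl.le] at e
      exact hp.getVert_injOn (Set.mem_ofPred.2 hk.le) (Set.mem_ofPred.2 hl.le) e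
    · obtain ⟨l, rfl⟩ := Nat.exists_eq_add_of_le hl
      exact absurd e (hgR k l hk)
    · obtain ⟨k, rfl⟩ := Nat.exists_eq_add_of_le hk
      exact absurd e.symm (hgR l k hl)
    · obtain ⟨k, rfl⟩ := Nat.exists_eq_add_of_le hk
      obtain ⟨l, rfl⟩ := Nat.exists_eq_add_of_le hl
      rw [hg', hg'] at e
      have := R.inj e
      omega
  · intro k
    rcases lt_or_ge k p.length with hk | hk
    · rw [hg k hk.le, hg (k + 1) hk]
      exact p.adj_getVert_succ hk
    · obtain ⟨k, rfl⟩ := Nat.exists_eq_add_of_le hk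
      rw [hg', add_assoc, hg']
      exact R.adj (m + k)
  · change g 0 = v
    rw [hg 0 (Nat.zero_le _), Walk.getVert_zero]
  · rintro _ ⟨k, rfl⟩
    change g k ∈ K
    rcases lt_or_ge k p.length with hk | hk
    · rw [hg k hk.le]
      exact hpK _ (p.getVert_mem_support k)
    · obtain ⟨k, rfl⟩ := Nat.exists_eq_add_of_le hk
      rw [hg']
      exact hRK ⟨_, rfl⟩

/-- Two rays that share precisely their first vertex form a double ray. -/
def DoubleRay.ofRays (R S : G.Ray) (h0 : R.vert 0 = S.vert 0)
    (h : ∀ m n, R.vert m = S.vert (n + 1) → False) : G.DoubleRay where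
  vert z := if 0 ≤ z then R.vert z.toNat else S.vert (-z).toNat
  inj a b e := by
    have key : ∀ c d : ℤ, 0 ≤ c → ¬ 0 ≤ d → R.vert c.toNat ≠ S.vert (-d).toNat := by
      intro c d _ hd e
      obtain ⟨n, hn⟩ : ∃ n, (-d).toNat = n + 1 := ⟨(-d).toNat - 1, by omega⟩
      exact h _ n (hn ▸ e)
    by_cases ha : 0 ≤ a <;> by_cases hb : 0 ≤ b <;> simp only [ha, hb, if_true, if_false] at e
    · have := R.inj e
      omega
    · exact absurd e (key a b ha hb)
    · exact absurd e.symm (key b a hb ha)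
    · have := S.inj e
      omega
  adj z := by
    by_cases hz : 0 ≤ z
    · have h1 : 0 ≤ z + 1 := by omega
      have h2 : (z + 1).toNat = z.toNat + 1 := by omega
      simp only [hz, h1, if_true, h2]
      exact R.adj _
    · have h2 : (-z).toNat = (-(z + 1)).toNat + 1 := by omega
      simp only [hz, if_false]
      split_ifs with h1
      · have : z = -1 := by omega
        subst this
        simpa [h0] using (S.adj 0).symm
      · rw [h2]
        exact (S.adj _).symm

theorem DoubleRay.verts_ofRays_subset {R S : G.Ray} {h0 h} {K : Set V} (hR : R.verts ⊆ K)
    (hS : S.verts ⊆ K) : (DoubleRay.ofRays R S h0 h).verts ⊆ K := by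
  rintro _ ⟨z, rfl⟩
  simp only [DoubleRay.ofRays]
  split_ifs
  exacts [hR ⟨_, rfl⟩, hS ⟨_, rfl⟩]

theorem DoubleRay.fwd_ofRays {R S : G.Ray} {h0 h} : (DoubleRay.ofRays R S h0 h).fwd.toEnd = R.toEnd :=
  Ray.toEnd_eq_of_shift (i := 0) (m := 0) fun k => by simp [DoubleRay.ofRays, DoubleRay.fwd]

theorem DoubleRay.bwd_ofRays {R S : G.Ray} {h0 h} : (DoubleRay.ofRays R S h0 h).bwd.toEnd = S.toEnd :=
  Ray.toEnd_eq_of_shift (i := 1) (m := 1) fun k => by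
    have : ¬ (0 : ℤ) ≤ -((1 + k : ℕ) : ℤ) := by omega
    have h2 : (- -((1 + k : ℕ) : ℤ)).toNat = 1 + k := by omega
    simp only [DoubleRay.ofRays, DoubleRay.bwd, this, if_false, h2]

/-- In a connected set, inequivalent rays are linked by a double ray. -/
theorem exists_doubleRay {K : Set V} (hK : G.ConnectedSet K) {R S : G.Ray} (hR : R.verts ⊆ K)
    (hS : S.verts ⊆ K) (hne : R.toEnd ≠ S.toEnd) :
    ∃ D : G.DoubleRay, D.verts ⊆ K ∧ D.bwd.toEnd = R.toEnd ∧ D.fwd.toEnd = S.toEnd := by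
  classical
  obtain ⟨X, hX⟩ := RayEnd.exists_comp_ne hne
  have hdrop : ∀ m, (R.drop m).verts ⊆ K := by
    rintro m _ ⟨k, rfl⟩
    exact hR ⟨_, rfl⟩
  set T := R.drop (R.idx X) with hT
  obtain ⟨S', hS'0, hS'K, i, m, hS'⟩ := S.exists_ray_from hK hS (hdrop (R.idx X) ⟨0, rfl⟩)
  have hbound : ∀ n, S'.vert n ∈ T.verts → n ≤ i + S.idx X := by
    rintro n ⟨k, hk⟩
    by_contra hn
    obtain ⟨j, rfl⟩ : ∃ j, n = i + j := ⟨n - i, by omega⟩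
    rw [hS'] at hk
    refine hX (ComponentCompl.eq_of_mem (x := T.vert k) (R.vert_mem_comp X ?_) ?_)
    · omega
    · rw [hk]
      exact S.vert_mem_comp X (by omega)
  let P : ℕ → Prop := fun n => S'.vert n ∈ T.verts
  have hP0 : P 0 := ⟨0, hS'0.symm⟩
  let n := Nat.findGreatest P (i + S.idx X)
  obtain ⟨t, ht⟩ : P n := Nat.findGreatest_spec (P := P) (Nat.zero_le _) hP0
  have hmax : ∀ j, n < j → ¬ P j := fun j hj hPj =>
    Nat.findGreatest_is_greatest hj (hbound j hPj) hPj
  have h0 : (S'.drop n).vert 0 = (T.drop t).vert 0 := ht.symm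
  have hdisj : ∀ a b, (S'.drop n).vert a = (T.drop t).vert (b + 1) → False := by
    intro a b e
    change S'.vert (n + a) = T.vert (t + (b + 1)) at e
    rcases Nat.eq_zero_or_pos a with rfl | ha
    · have := T.inj (ht.trans e)
      omega
    · exact hmax (n + a) (by omega) ⟨_, e.symm⟩
  refine ⟨.ofRays (S'.drop n) (T.drop t) h0 hdisj, ?_, ?_, ?_⟩
  · apply DoubleRay.verts_ofRays_subset
    · rintro _ ⟨k, rfl⟩
      exact hS'K ⟨_, rfl⟩
    · rintro _ ⟨k, rfl⟩
      exact hR ⟨_, rfl⟩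
  · rw [DoubleRay.bwd_ofRays, Ray.toEnd_drop, hT, Ray.toEnd_drop]
  · rw [DoubleRay.fwd_ofRays, Ray.toEnd_drop, Ray.toEnd_eq_of_shift hS']

/-! ### Directions and the sets they meet -/

/-- The vertex `v` cannot be separated from the direction `f` by finitely many other vertices. -/
def Direction.DominatedBy (f : G.Direction) (v : V) : Prop :=
  ∀ X : Finset V, v ∉ X → v ∈ f.comp X

/-- No finite set of vertices separates `L` from the direction `f`. -/
def Direction.Meets (f : G.Direction) (L : Set V) : Prop :=
  ∀ X : Finset V, ∃ x ∈ L, x ∈ f.comp X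

theorem Direction.exists_separator {f : G.Direction} {v : V} (h : ¬ f.DominatedBy v) :
    ∃ X : Finset V, v ∉ X ∧ v ∉ f.comp X := by
  simpa [Direction.DominatedBy] using h

theorem Direction.not_adj_comp {f : G.Direction} {v w : V} {X : Finset V} (hv : v ∉ X)
    (hv' : v ∉ f.comp X) (hw : w ∈ f.comp X) : ¬ G.Adj v w := fun h =>
  hv' (ComponentCompl.mem_of_adj w v hw hv h.symm)

/-- Deleting finitely many vertices that do not dominate `f` from a connected set meeting `f`
leaves a component that meets `f`. -/
theorem Direction.Meets.exists_component {f : G.Direction} {L : Set V} (hf : f.Meets L)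
    (hL : G.ConnectedSet L) (F : Finset V) (hF : ∀ v ∈ F, v ∈ L → ¬ f.DominatedBy v) :
    ∃ x ∈ L, x ∉ F ∧ f.Meets {y | G.Joined (L \ F) x y} := by
  classical
  by_cases hFL : ∃ v ∈ F, v ∈ L
  swap
  · push Not at hFL
    obtain ⟨x, hx, -⟩ := hf ∅
    have e : L \ F = L := by
      ext y
      simp only [Set.mem_sdiff, Finset.mem_coe, and_iff_left_iff_imp]
      exact fun hy hyF => hFL y hyF hy
    refine ⟨x, hx, fun h => hFL x h hx, fun X => ?_⟩
    obtain ⟨y, hy, hy'⟩ := hf X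
    exact ⟨y, by simpa [e] using hL x hx y hy, hy'⟩
  obtain ⟨v₀, hv₀F, hv₀L⟩ := hFL
  by_contra hcon
  have hcon' : ∀ x, ∃ Z : Finset V, x ∈ L → x ∉ F → ∀ y, G.Joined (L \ F) x y → y ∉ f.comp Z := by
    intro x
    by_cases hx : x ∈ L ∧ x ∉ F
    · by_contra h
      push Not at h
      exact hcon ⟨x, hx.1, hx.2, fun X => (h X).2.2⟩
    · exact ⟨∅, fun h1 h2 => absurd ⟨h1, h2⟩ hx⟩
  have hsep : ∀ v, ∃ X : Finset V, v ∈ F → v ∈ L → v ∉ X ∧ v ∉ f.comp X := by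
    intro v
    by_cases hv : v ∈ F ∧ v ∈ L
    · obtain ⟨X, hX⟩ := Direction.exists_separator (hF v hv.1 hv.2)
      exact ⟨X, fun _ _ => hX⟩
    · exact ⟨∅, fun h1 h2 => absurd ⟨h1, h2⟩ hv⟩
  choose Z hZ using hcon'
  choose X hX using hsep
  let Y := F.biUnion X
  obtain ⟨y, hyL, hy⟩ := hf (Y ∪ Y.biUnion Z)
  have hyX : ∀ v ∈ F, y ∈ f.comp (X v) := fun v hv =>
    f.comp_anti ((Finset.subset_biUnion_of_mem X hv).trans Finset.subset_union_left) hy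
  by_cases hyF : y ∈ F
  · exact (hX y hyF hyL).2 (hyX y hyF)
  obtain ⟨a, b, ha, -, hbL, hb, hab⟩ := (hL y hyL v₀ hv₀L).exists_adj_leaving
    (B := {z | G.Joined (L \ F) y z}) (Joined.refl ⟨hyL, hyF⟩) fun h => h.right_mem.2 hv₀F
  have hbF : b ∈ F := by
    by_contra hbF
    exact hb (ha.trans (.of_adj hab ha.right_mem ⟨hbL, hbF⟩))
  have hmeet : ∃ z ∈ X b, G.Joined (L \ F) y z := by
    by_contra hno
    push Not at hno
    have hsub := ComponentCompl.subset_of_connectedSet (C := f.comp (X b))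
      (connectedSet_component (L \ F) y)
      (Set.disjoint_left.2 fun z hz hz' => hno z hz' hz)
      (Joined.refl ⟨hyL, hyF⟩) (hyX b hbF)
    exact Direction.not_adj_comp (hX b hbF hbL).1 (hX b hbF hbL).2 (hsub ha) hab.symm
  obtain ⟨z, hzX, hyz⟩ := hmeet
  refine hZ z hyz.right_mem.1 hyz.right_mem.2 y hyz.symm ?_
  exact f.comp_anti ((Finset.subset_biUnion_of_mem Z
    (Finset.mem_biUnion.2 ⟨b, hbF, hzX⟩)).trans Finset.subset_union_right) hy

/-- A connected set that meets `f` but contains no vertex dominating `f` contains a ray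
converging to `f`. -/
theorem Direction.Meets.exists_ray {f : G.Direction} {K : Set V} (hf : f.Meets K)
    (hK : G.ConnectedSet K) (hdom : ∀ v ∈ K, ¬ f.DominatedBy v) :
    ∃ R : G.Ray, R.verts ⊆ K ∧ ∀ X, R.comp X = f.comp X := by
  classical
  let σ := {L : Set V // L ⊆ K ∧ G.ConnectedSet L ∧ f.Meets L ∧
    ∃ Z : Finset V, ∀ a ∈ L, ∀ b ∈ K, G.Adj a b → b ∉ L → b ∈ Z}
  have step : ∀ L : σ, ∃ L' : σ, L'.1 ⊆ L.1 ∧ ∀ a ∈ L'.1, ∀ b ∈ K, G.Adj a b → b ∈ L.1 := by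
    rintro ⟨L, hLK, hL, hfL, Z, hZ⟩
    have hsep : ∀ v, ∃ X : Finset V, v ∈ K → v ∉ X ∧ v ∉ f.comp X := by
      intro v
      by_cases hv : v ∈ K
      · obtain ⟨X, hX⟩ := Direction.exists_separator (hdom v hv)
        exact ⟨X, fun _ => hX⟩
      · exact ⟨∅, fun h => absurd h hv⟩
    choose X hX using hsep
    obtain ⟨x, hxL, hxF, hfx⟩ := hfL.exists_component hL (Z.biUnion X) fun v _ hv => hdom v (hLK hv)
    have hsub : {y | G.Joined (L \ (Z.biUnion X : Finset V)) x y} ⊆ L := fun y hy => hy.right_mem.1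
    refine ⟨⟨_, hsub.trans hLK, connectedSet_component _ x, hfx, Z ∪ Z.biUnion X, ?_⟩, hsub, ?_⟩
    · intro a ha b hb hab hb'
      rw [Finset.mem_union]
      by_cases hbL : b ∈ L
      · by_contra hcon
        exact hb' (Joined.trans ha (.of_adj hab ha.right_mem ⟨hbL, fun h => hcon (.inr h)⟩))
      · exact .inl (hZ a (hsub ha) b hb hab hbL)
    · intro a ha b hb hab
      by_contra hbL
      have hbZ := hZ a (hsub ha) b hb hab hbL
      obtain ⟨y, hy, hyX⟩ := hfx (X b)
      have := ComponentCompl.subset_of_connectedSet (C := f.comp (X b))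
        (connectedSet_component (L \ (Z.biUnion X : Finset V)) x)
        (Set.disjoint_left.2 fun z hz hz' => hz.right_mem.2
          (Finset.mem_coe.2 (Finset.mem_biUnion.2 ⟨b, hbZ, hz'⟩))) hy hyX
      exact Direction.not_adj_comp (hX b hb).1 (hX b hb).2 (this ha) hab.symm
  choose next hnext hnext' using step
  obtain ⟨x₀, hx₀, -⟩ := hf ∅
  obtain ⟨x, hx, hxF, hfx⟩ := hf.exists_component hK {x₀} fun v _ hv => hdom v hv
  let L₀ : σ := ⟨{y | G.Joined (K \ ({x₀} : Finset V)) x y}, fun y hy => hy.right_mem.1,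
    connectedSet_component _ x, hfx, {x₀}, fun a ha b hb hab hb' => by
      by_contra hcon
      exact hb' (Joined.trans ha (.of_adj hab ha.right_mem ⟨hb, hcon⟩))⟩
  let L : ℕ → σ := fun n => n.rec L₀ fun _ t => next t
  have hanti : Antitone fun n => (L n).1 := antitone_nat_of_succ_le fun n => hnext (L n)
  have hinter : ∀ y, ∃ n, y ∉ (L n).1 := by
    intro y
    by_contra hy
    push Not at hy
    have hyx := hK y ((L 0).2.1 (hy 0)) x₀ hx₀
    have := hyx.mem_of_closed (B := {z | ∀ n, z ∈ (L n).1}) hy fun a b ha _ hb hab n =>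
      hnext' (L n) a (ha (n + 1)) b hb hab
    exact (this 0).right_mem.2 (by simp)
  obtain ⟨R, hRL, hR⟩ := exists_ray_of_nested_connectedSets (fun n => (L n).1) hanti
    (fun n => (by obtain ⟨z, hz, -⟩ := (L n).2.2.2.1 ∅; exact ⟨z, hz⟩)) (fun n => (L n).2.2.1) hinter
  refine ⟨R, hRL.trans (L 0).2.1, fun X => ?_⟩
  choose N hN using hinter
  obtain ⟨z, hz, hzX⟩ := (L (X.sup N)).2.2.2.1 X
  have hsub := ComponentCompl.subset_of_connectedSet (C := f.comp X) (L (X.sup N)).2.2.1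
    (Set.disjoint_left.2 fun y hy hyX => hN y (hanti (Finset.le_sup (f := N) hyX) hy)) hz hzX
  obtain ⟨M, hM⟩ := hR (X.sup N)
  exact R.comp_eq_of_frequently fun m => ⟨max m M, le_max_left _ _, hsub (hM _ (le_max_right _ _))⟩

theorem RayEnd.direction_surjective :
    Function.Surjective (RayEnd.direction : G.RayEnd → G.Direction) := by
  classical
  intro f
  suffices ∃ R : G.Ray, ∀ X, R.comp X = f.comp X by
    obtain ⟨R, hR⟩ := this
    exact ⟨R.toEnd, Direction.ext_comp hR⟩
  by_cases hU : {v | f.DominatedBy v}.Infinite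
  · obtain ⟨R, hR⟩ := exists_ray_of_infinite_inseparable (G := G) hU fun X u hu v hv huX hvX =>
      ComponentCompl.joined_of_mem (C := f.comp X) (hu X huX) (hv X hvX)
    refine ⟨R, fun X => R.comp_eq_of_frequently fun N => ?_⟩
    obtain ⟨n, hn, hnU, hnX⟩ := hR X N
    exact ⟨n, hn, hnU X hnX⟩
  · rw [Set.not_infinite] at hU
    have hf : f.Meets (f.comp hU.toFinset : Set V) := by
      intro X
      obtain ⟨x, hx⟩ := (f.comp (X ∪ hU.toFinset)).nonempty
      exact ⟨x, f.comp_anti Finset.subset_union_right hx, f.comp_anti Finset.subset_union_left hx⟩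
    obtain ⟨R, -, hR⟩ := hf.exists_ray (f.comp hU.toFinset).connectedSet fun v hv hv' =>
      ComponentCompl.notMem_of_mem hv (by simpa using hv')
    exact ⟨R, hR⟩

/-! ### Domination -/

theorem Ray.exists_disjoint_path_to {R : G.Ray} {v : V} (h : R.toEnd.direction.DominatedBy v)
    (F : Finset V) (hF : v ∉ F) : ∃ w, w ∈ R.verts ∧ w ≠ v ∧ ∃ p : G.Walk v w, p.IsPath ∧
      (∀ x ∈ p.support, x ∉ F) ∧ ∀ x ∈ p.support, x ∈ R.verts → x = v ∨ x = w := by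
  have hv := h F hF
  obtain ⟨n, hn, hnv⟩ : ∃ n, R.idx F ≤ n ∧ R.vert n ≠ v := by
    by_contra hcon
    push Not at hcon
    have := R.inj ((hcon _ le_rfl).trans (hcon (R.idx F + 1) (by omega)).symm)
    omega
  obtain ⟨w, ⟨hwR, hwv⟩, p, hp, hpF, hpR⟩ := (ComponentCompl.joined_of_mem hv
    (R.vert_mem_comp F hn)).exists_path_to (B := R.verts \ {v}) ⟨⟨n, rfl⟩, hnv⟩
  exact ⟨w, hwR, hwv, p, hp, hpF, fun x hx hxR => or_iff_not_imp_left.2 fun hxv =>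
    hpR x hx ⟨hxR, hxv⟩⟩

theorem dominates_of_dominatedBy {ω : G.RayEnd} {v : V} (h : ω.direction.DominatedBy v) :
    Dominates v ω := by
  classical
  obtain ⟨R, rfl⟩ := ω.exists_ray
  refine ⟨R, rfl, ?_⟩
  choose w hwR hwv p hp hpF hpR using fun F : {F : Finset V // v ∉ F} =>
    Ray.exists_disjoint_path_to h F.1 F.2
  let F : ℕ → {F : Finset V // v ∉ F} := fun n => n.rec ⟨∅, by simp⟩ fun _ F =>
    ⟨F.1 ∪ (p F).support.toFinset.erase v, by simp [F.2]⟩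
  have hF : ∀ n, (F (n + 1)).1 = (F n).1 ∪ (p (F n)).support.toFinset.erase v := fun n => rfl
  have hmono : Monotone fun n => (F n).1 := monotone_nat_of_le_succ fun n => by
    rw [hF]
    exact Finset.subset_union_left
  have key : ∀ k l, k < l → ∀ x, x ∈ (p (F k)).support → x ∈ (p (F l)).support → x = v := by
    intro k l hkl x hk hl
    by_contra hxv
    refine hpF (F l) x hl (hmono (Nat.succ_le_of_lt hkl) ?_)
    simp only [Nat.succ_eq_add_one, hF]
    simp [hxv, hk]
  refine ⟨fun k => w (F k), fun k => p (F k), fun k => ⟨hp _, hwv _, hwR _, hpR _⟩, ?_⟩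
  intro k l hkl x hk hl
  rcases lt_or_gt_of_ne hkl with h | h
  exacts [key k l h x hk hl, key l k h x hl hk]

theorem Dominates.dominatedBy {ω : G.RayEnd} {v : V} (h : Dominates v ω) :
    ω.direction.DominatedBy v := by
  classical
  obtain ⟨R, rfl, w, p, hp, hdisj⟩ := h
  intro X hvX
  let B := (X : Set V) ∪ R.vert '' {n | n < R.idx X}
  have hB : (B \ {v}).Finite :=
    (X.finite_toSet.union ((Set.finite_lt_nat _).image _)).subset Set.sdiff_subset
  obtain ⟨k, hk⟩ : ∃ k, ∀ x ∈ (p k).support, x ∉ B \ {v} := by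
    by_contra hcon
    push Not at hcon
    choose x hx hxB using hcon
    have hinj : Function.Injective x := by
      intro k l hkl
      by_contra hne
      exact (hxB k).2 (hdisj k l hne _ (hx k) (hkl ▸ hx l))
    exact Set.infinite_of_injective_forall_mem hinj hxB hB
  have hjoin : G.Joined (X : Set V)ᶜ v (w k) := by
    refine ⟨p k, fun x hx hxX => hk x hx ⟨.inl hxX, ?_⟩⟩
    rintro rfl
    exact hvX hxX
  obtain ⟨n, hn⟩ := (hp k).2.2.1
  have hnX : R.idx X ≤ n := by
    by_contra hlt
    exact hk (w k) (p k).end_mem_support ⟨.inr ⟨n, by simpa using hlt, hn⟩, (hp k).2.1⟩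
  have hw : w k ∈ R.comp X := hn ▸ R.vert_mem_comp X hnX
  exact ComponentCompl.mem_of_joined hw hjoin.symm

/-! ### Comparing components of different finite sets -/

theorem RayEnd.comp_eq_of_subset {ω ω' : G.RayEnd} {X Y : Finset V} (hXY : X ⊆ Y)
    (h : ω'.comp Y = ω.comp Y) : ω'.comp X = ω.comp X := by
  obtain ⟨x, hx⟩ := (ω.comp Y).nonempty
  exact ComponentCompl.eq_of_mem (ω'.comp_anti hXY (h ▸ hx)) (ω.comp_anti hXY hx)

theorem RayEnd.comp_subset_of_disjoint (ω : G.RayEnd) {X Y : Finset V}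
    (h : Disjoint (ω.comp Y : Set V) (X : Set V)) : (ω.comp Y : Set V) ⊆ ω.comp X := by
  classical
  obtain ⟨x, hx⟩ := (ω.comp (X ∪ Y)).nonempty
  exact ComponentCompl.subset_of_connectedSet (ω.comp Y).connectedSet h
    (ω.comp_anti Finset.subset_union_right hx) (ω.comp_anti Finset.subset_union_left hx)

/-! ### The neighbourhoods of an end -/

theorem RayEnd.nhds_hasBasis (ω : G.RayEnd) : (𝓝 ω).HasBasis (fun _ : Finset V => True)
    fun X => {ω' | ω'.comp X = ω.comp X} := by
  classical
  have h : 𝓝 ω = ⨅ X : Finset V, Filter.principal {ω' : G.RayEnd | ω'.comp X = ω.comp X} := by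
    rw [TopologicalSpace.nhds_generateFrom]
    apply le_antisymm
    · exact le_iInf fun X => iInf₂_le _ ⟨rfl, X, _, rfl⟩
    · refine le_iInf₂ ?_
      rintro _ ⟨hω, X, C, rfl⟩
      obtain rfl : ω.comp X = C := hω
      exact iInf_le _ X
  rw [h]
  refine Filter.hasBasis_iInf_principal fun X Y => ⟨X ∪ Y, ?_, ?_⟩
  · exact fun _ => RayEnd.comp_eq_of_subset Finset.subset_union_left
  · exact fun _ => RayEnd.comp_eq_of_subset Finset.subset_union_right

theorem countable_finsets_subset {W : Set V} (hW : W.Countable) :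
    {X : Finset V | (X : Set V) ⊆ W}.Countable := by
  have h := (Set.countable_ofPred_finite_subset hW).preimage_of_injOn
    (f := fun X : Finset V => (X : Set V)) Finset.coe_injective.injOn
  exact h.mono fun X hX => Set.mem_preimage.2 (Set.mem_ofPred.2 ⟨X.finite_toSet, hX⟩)

theorem RayEnd.isCountablyGenerated_of_countable {ω : G.RayEnd} {W : Set V} (hW : W.Countable)
    (h : ∀ Y : Finset V, ∃ X : Finset V, (X : Set V) ⊆ W ∧
      ∀ ω' : G.RayEnd, ω'.comp X = ω.comp X → ω'.comp Y = ω.comp Y) :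
    (𝓝 ω).IsCountablyGenerated := by
  have hb : (𝓝 ω).HasBasis (fun X : Finset V => (X : Set V) ⊆ W)
      fun X => {ω' | ω'.comp X = ω.comp X} := by
    refine ω.nhds_hasBasis.to_hasBasis (fun Y _ => h Y) fun X _ => ⟨X, trivial, subset_rfl⟩
  exact Filter.HasCountableBasis.isCountablyGenerated ⟨hb, countable_finsets_subset hW⟩

theorem RayEnd.countablyDetermined_of_isCountablyGenerated {ω : G.RayEnd}
    (h : (𝓝 ω).IsCountablyGenerated) : ω.direction.CountablyDetermined := by
  obtain ⟨X, -, hX⟩ := ω.nhds_hasBasis.exists_antitone_subbasis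
  refine ⟨Set.range fun n => ⟨X n, ω.comp (X n)⟩, Set.countable_range _, fun g hg => ?_⟩
  obtain ⟨ω', rfl⟩ := RayEnd.direction_surjective g
  have hne : ω' ≠ ω := fun e => hg (by rw [e])
  obtain ⟨Y, hY⟩ := RayEnd.exists_comp_ne hne
  obtain ⟨n, -, hn⟩ := hX.1.mem_iff.1 (ω.nhds_hasBasis.mem_of_mem (i := Y) trivial)
  exact ⟨_, ⟨n, rfl⟩, rfl, fun e => hY (hn e)⟩

/-! ### Capturing sets -/

/-- The trace `Y ∩ W` of a finite set `Y` separates no more vertices of `W` from the end `ω` than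
`Y` does. -/
def RayEnd.CapturedBy (ω : G.RayEnd) (W : Set V) : Prop :=
  ∀ X Y : Finset V, (X : Set V) = (Y : Set V) ∩ W → ∀ l ∈ W, l ∈ ω.comp X → l ∈ ω.comp Y

theorem Ray.exists_finset_linking (R : G.Ray) (X : Finset V) (l : V) : ∃ Q : Finset V,
    l ∈ R.comp X → ∃ n, R.idx X ≤ n ∧ G.Joined ((X : Set V)ᶜ ∩ Q) l (R.vert n) := by
  classical
  by_cases hl : l ∈ R.comp X
  · obtain ⟨p, hp⟩ := ComponentCompl.joined_of_mem hl (R.vert_mem_comp X le_rfl)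
    exact ⟨p.support.toFinset, fun _ => ⟨_, le_rfl, p, fun z hz => ⟨hp z hz, by simpa using hz⟩⟩⟩
  · exact ⟨∅, fun h => absurd h hl⟩

theorem RayEnd.exists_capturedBy (ω : G.RayEnd) {U : Set V} (hU : U.Countable) :
    ∃ W, W.Countable ∧ U ⊆ W ∧ ω.CapturedBy W := by
  obtain ⟨R, rfl⟩ := ω.exists_ray
  choose Q hQ using R.exists_finset_linking
  let W : ℕ → Set V := fun n => n.rec (U ∪ R.verts) fun _ A =>
    A ∪ ⋃ X ∈ {X : Finset V | (X : Set V) ⊆ A}, ⋃ l ∈ A, (Q X l : Set V)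
  have hsucc : ∀ n, W (n + 1) =
    W n ∪ ⋃ X ∈ {X : Finset V | (X : Set V) ⊆ W n}, ⋃ l ∈ W n, (Q X l : Set V) := fun _ => rfl
  have hmono : Monotone W := monotone_nat_of_le_succ fun n => by
    rw [hsucc]
    exact Set.subset_union_left
  have hcount : ∀ n, (W n).Countable := by
    intro n
    induction n with
    | zero => exact hU.union (Set.countable_range _)
    | succ n ih =>
      rw [hsucc]
      exact ih.union ((countable_finsets_subset ih).biUnion fun X _ =>
        ih.biUnion fun l _ => (Q X l).countable_toSet)
  refine ⟨⋃ n, W n, Set.countable_iUnion hcount,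
    Set.subset_union_left.trans (Set.subset_iUnion W 0), ?_⟩
  intro X Y hXY l hl hlX
  obtain ⟨n, hXn, hln⟩ : ∃ n, (X : Set V) ⊆ W n ∧ l ∈ W n := by
    obtain ⟨m, hm⟩ := Set.mem_iUnion.1 hl
    have hX : ∀ x, ∃ n, x ∈ X → x ∈ W n := by
      intro x
      by_cases hx : x ∈ X
      · obtain ⟨n, hn⟩ := Set.mem_iUnion.1 ((hXY ▸ (Finset.mem_coe.2 hx) :
          x ∈ (Y : Set V) ∩ ⋃ n, W n)).2
        exact ⟨n, fun _ => hn⟩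
      · exact ⟨0, fun h => absurd h hx⟩
    choose N hN using hX
    exact ⟨max m (X.sup N), fun x hx => hmono ((Finset.le_sup (f := N) hx).trans (le_max_right _ _))
      (hN x hx), hmono (le_max_left _ _) hm⟩
  have havoid : ∀ z, z ∉ X → z ∈ ⋃ n, W n → z ∉ Y := fun z hzX hzW hzY =>
    hzX (Finset.mem_coe.1 (hXY ▸ ⟨hzY, hzW⟩))
  obtain ⟨k, hk, hjoin⟩ := hQ X l hlX
  have hR : R.vert k ∈ R.comp Y := R.vert_mem_comp_of_avoids fun m hm =>
    havoid _ (R.notMem_of_idx_le X (hk.trans hm)) (Set.mem_iUnion.2 ⟨0, .inr ⟨m, rfl⟩⟩)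
  refine ComponentCompl.mem_of_joined hR (hjoin.symm.mono ?_)
  rintro z ⟨hzX, hzQ⟩
  refine havoid z hzX (Set.mem_iUnion.2 ⟨n + 1, .inr ?_⟩)
  exact Set.mem_biUnion (show X ∈ {X : Finset V | (X : Set V) ⊆ W n} from hXn)
    (Set.mem_biUnion hln hzQ)

theorem RayEnd.CapturedBy.disjoint_comp {ω ω' : G.RayEnd} {W : Set V} (hW : ω.CapturedBy W)
    {X Y : Finset V} (hXY : (X : Set V) = (Y : Set V) ∩ W) (hX : ω'.comp X = ω.comp X)
    (hY : ω'.comp Y ≠ ω.comp Y) : Disjoint (ω'.comp Y : Set V) W := by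
  refine Set.disjoint_left.2 fun w hw hwW => hY (ComponentCompl.eq_of_mem hw ?_)
  refine hW X Y hXY w hwW (hX ▸ ω'.comp_anti ?_ hw)
  exact Finset.coe_subset.1 (hXY ▸ Set.inter_subset_left)

theorem exists_finset_inter (Y : Finset V) (W : Set V) :
    ∃ X : Finset V, (X : Set V) = (Y : Set V) ∩ W :=
  (Y.finite_toSet.inter_of_left W).exists_finset_coe

theorem RayEnd.isCountablyGenerated_of_countablyDetermined {ω : G.RayEnd}
    (h : ω.direction.CountablyDetermined) : (𝓝 ω).IsCountablyGenerated := by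
  classical
  obtain ⟨S, hS, hdet⟩ := h
  obtain ⟨W, hWc, hUW, hW⟩ := ω.exists_capturedBy
    (hS.biUnion fun p _ => p.1.countable_toSet)
  have hSW : ∀ p ∈ S, (p.1 : Set V) ⊆ W := fun p hp =>
    (Set.subset_biUnion_of_mem (u := fun p : Σ X : Finset V, G.ComponentCompl (X : Set V) =>
      (p.1 : Set V)) hp).trans hUW
  refine RayEnd.isCountablyGenerated_of_countable hWc ?_
  by_contra hcon
  push Not at hcon
  obtain ⟨Y, hY⟩ := hcon
  obtain ⟨X, hXY⟩ := exists_finset_inter Y W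
  have hXW : (X : Set V) ⊆ W := hXY ▸ Set.inter_subset_right
  have hXY' : X ⊆ Y := Finset.coe_subset.1 (hXY ▸ Set.inter_subset_left)
  have key : ∀ X' : Finset V, (X' : Set V) ⊆ W → X ⊆ X' → ∃ b ∈ Y, b ∉ W ∧ b ∈ ω.comp X' ∧
      ∃ ω' : G.RayEnd, ω'.comp Y ≠ ω.comp Y ∧ Disjoint (ω'.comp Y : Set V) W ∧
        ∃ a ∈ ω'.comp Y, G.Adj a b := by
    intro X' hX'W hXX'
    obtain ⟨ω', hω', hne⟩ := hY X' hX'W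
    have hX : ω'.comp X = ω.comp X := RayEnd.comp_eq_of_subset hXX' hω'
    have hdisj := hW.disjoint_comp hXY hX hne
    obtain ⟨c, hc⟩ := (ω'.comp Y).nonempty
    obtain ⟨d, hd⟩ := (ω.comp Y).nonempty
    have hcX : c ∈ ω.comp X := hX ▸ ω'.comp_anti hXY' hc
    obtain ⟨a, b, ha, -, hbX, hb, hab⟩ := ((ω.comp X).connectedSet c hcX d
      (ω.comp_anti hXY' hd)).exists_adj_leaving (B := (ω'.comp Y : Set V)) hc
      fun h => hne (ComponentCompl.eq_of_mem h hd)
    have hbY : b ∈ Y := by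
      by_contra hbY
      exact hb (ComponentCompl.mem_of_adj a b ha hbY hab)
    have hbW : b ∉ W := fun hbW =>
      ComponentCompl.notMem_of_mem hbX (hXY ▸ ⟨hbY, hbW⟩)
    have ha' : a ∈ ω.comp X' := hω' ▸ ω'.comp_subset_of_disjoint (hdisj.mono_right hX'W) ha
    exact ⟨b, hbY, hbW, ComponentCompl.mem_of_adj a b ha' (fun h => hbW (hX'W h)) hab,
      ω', hne, hdisj, a, ha, hab⟩
  obtain ⟨b, hbW, hbX, ω', hne, hdisj, a, ha, hab⟩ : ∃ b, b ∉ W ∧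
      (∀ X' : Finset V, (X' : Set V) ⊆ W → b ∈ ω.comp X') ∧
      ∃ ω' : G.RayEnd, ω'.comp Y ≠ ω.comp Y ∧ Disjoint (ω'.comp Y : Set V) W ∧
        ∃ a ∈ ω'.comp Y, G.Adj a b := by
    by_contra hno
    have hsep : ∀ b, ∃ Z : Finset V, (Z : Set V) ⊆ W ∧
        ((∃ X' : Finset V, (X' : Set V) ⊆ W ∧ b ∉ ω.comp X') → b ∉ ω.comp Z) := by
      intro b
      by_cases hb : ∃ X' : Finset V, (X' : Set V) ⊆ W ∧ b ∉ ω.comp X'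
      · obtain ⟨Z, hZ, hZ'⟩ := hb
        exact ⟨Z, hZ, fun _ => hZ'⟩
      · exact ⟨∅, by simp, fun h => absurd h hb⟩
    choose Z hZW hZ using hsep
    obtain ⟨b, hbY, hbW, hbX, hω'⟩ := key (X ∪ Y.biUnion Z) (by
      simp only [Finset.coe_union, Finset.coe_biUnion, Set.union_subset_iff, Set.iUnion_subset_iff]
      exact ⟨hXW, fun b _ => hZW b⟩) Finset.subset_union_left
    refine hno ⟨b, hbW, fun X' hX' => ?_, hω'⟩
    by_contra hb
    exact hZ b ⟨X', hX', hb⟩ (ω.comp_anti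
      ((Finset.subset_biUnion_of_mem Z hbY).trans Finset.subset_union_right) hbX)
  obtain ⟨p, hp, hp1, hp2⟩ := hdet ω'.direction fun e =>
    hne (by rw [RayEnd.direction_injective e])
  refine hp2 ((ComponentCompl.eq_of_mem (x := a) ?_ ?_).trans hp1)
  · exact ω'.comp_subset_of_disjoint (hdisj.mono_right (hSW p hp)) ha
  · exact ComponentCompl.mem_of_adj b a (hbX _ (hSW p hp))
      (fun h => Set.disjoint_left.1 hdisj ha (hSW p hp h)) hab.symm

/-! ### Suns obstruct countable determination -/

theorem DoubleRay.joined (D : G.DoubleRay) (m n : ℤ) : G.Joined D.verts (D.vert m) (D.vert n) := by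
  have key : ∀ (m : ℤ) (k : ℕ), G.Joined D.verts (D.vert m) (D.vert (m + k)) := by
    intro m k
    induction k with
    | zero =>
      have h : D.vert m ∈ D.verts := ⟨m, rfl⟩
      simpa using Joined.refl h
    | succ k ih =>
      refine ih.trans (.of_adj ?_ ⟨_, rfl⟩ ⟨_, rfl⟩)
      have := D.adj (m + k)
      rwa [add_assoc] at this
  rcases le_total m n with h | h
  · simpa [h] using key m (n - m).toNat
  · exact Joined.symm (by simpa [h] using key n (m - n).toNat)

theorem DoubleRay.comp_eq_of_disjoint {D : G.DoubleRay} {X : Finset V}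
    (h : Disjoint D.verts (X : Set V)) : D.bwd.comp X = D.fwd.comp X := by
  have h1 := D.bwd.vert_mem_comp X le_rfl
  have h2 := D.fwd.vert_mem_comp X le_rfl
  refine ComponentCompl.eq_of_mem (ComponentCompl.mem_of_joined h1 ?_) h2
  exact (D.joined _ _).mono fun z hz hzX => Set.disjoint_left.1 h hz hzX

theorem Ray.comp_eq_of_dominates {R : G.Ray} {ω : G.RayEnd} (hR : Dominates (R.vert 0) ω)
    {X : Finset V} (h : Disjoint R.verts (X : Set V)) : R.comp X = ω.comp X := by
  have hX : ∀ n, R.vert n ∉ X := fun n hn => Set.disjoint_left.1 h ⟨n, rfl⟩ hn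
  exact ComponentCompl.eq_of_mem (R.vert_mem_comp_of_avoids fun n _ => hX n)
    (hR.dominatedBy X (hX 0))

theorem IsSun.comp_eq_of_disjoint {I : Type u} {ω : G.RayEnd} {P : I → G.PathLike}
    {leaf : I → G.RayEnd} (h : IsSun ω P leaf) {i : I} {X : Finset V}
    (hX : Disjoint (P i).verts (X : Set V)) : (leaf i).comp X = ω.comp X := by
  have hP := (h.isGeneralisedPath i).2
  rcases h.proper with hD | hR
  · obtain ⟨D, hD⟩ := hD i
    rw [hD] at hP hX
    have := DoubleRay.comp_eq_of_disjoint (D := D) hX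
    rw [← Ray.toEnd_comp, ← Ray.toEnd_comp] at this
    rcases hP with ⟨h1, h2⟩ | ⟨h1, h2⟩
    · rw [← h1, ← h2, this]
    · rw [← h1, ← h2, this]
  · obtain ⟨R, hR, hR', hdom⟩ := hR i
    rw [hR] at hX
    rw [← hR', Ray.toEnd_comp]
    exact Ray.comp_eq_of_dominates hdom hX

/-- A countable set cannot meet all members of an uncountable disjoint family. -/
theorem exists_disjoint_of_uncountable {I : Type*} [Uncountable I] {A : I → Set V}
    (hA : ∀ i j, i ≠ j → Disjoint (A i) (A j)) {U : Set V} (hU : U.Countable) :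
    ∃ i, Disjoint (A i) U := by
  by_contra hcon
  push Not at hcon
  choose x hx hxU using fun i => Set.not_disjoint_iff.1 (hcon i)
  have hinj : Function.Injective fun i => (⟨x i, hxU i⟩ : U) := by
    intro i j e
    by_contra hne
    have e' : x i = x j := congrArg Subtype.val e
    exact Set.disjoint_left.1 (hA i j hne) (hx i) (e' ▸ hx j)
  have := hU.to_subtype
  exact not_countable (α := I) hinj.countable

theorem HasUncountableSun.not_countablyDetermined {ω : G.RayEnd} (h : HasUncountableSun ω) :
    ¬ ω.direction.CountablyDetermined := by
  obtain ⟨I, P, leaf, hI, h⟩ := h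
  rintro ⟨S, hS, hdet⟩
  obtain ⟨i, hi⟩ := exists_disjoint_of_uncountable h.disjoint
    (hS.biUnion fun p _ => p.1.countable_toSet)
  obtain ⟨p, hp, hp1, hp2⟩ := hdet (leaf i).direction fun e =>
    (h.isGeneralisedPath i).1 (RayEnd.direction_injective e).symm
  refine hp2 (Eq.trans ?_ hp1)
  exact h.comp_eq_of_disjoint (hi.mono_right (Set.subset_biUnion_of_mem
    (u := fun p : Σ X : Finset V, G.ComponentCompl (X : Set V) => (p.1 : Set V)) hp))

/-! ### Reformulations of uncountable suns -/

/-- The double ray traversed backwards. -/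
def DoubleRay.reverse (D : G.DoubleRay) : G.DoubleRay where
  vert n := D.vert (-n)
  inj m n h := by simpa using D.inj h
  adj n := by
    have h := (D.adj (-(n + 1))).symm
    have e : -(n + 1) + 1 = -n := by ring
    rwa [e] at h

theorem DoubleRay.verts_reverse (D : G.DoubleRay) : D.reverse.verts = D.verts :=
  (Equiv.neg ℤ).surjective.range_comp D.vert

theorem DoubleRay.bwd_reverse (D : G.DoubleRay) : D.reverse.bwd.toEnd = D.fwd.toEnd :=
  Ray.toEnd_eq_of_shift (i := 0) (m := 0) fun k => by
    simp [DoubleRay.reverse, DoubleRay.bwd, DoubleRay.fwd]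

theorem DoubleRay.fwd_reverse (D : G.DoubleRay) : D.reverse.fwd.toEnd = D.bwd.toEnd := rfl

theorem Ray.equivalent_iff_toEnd_eq {R S : G.Ray} : R.Equivalent S ↔ R.toEnd = S.toEnd := by
  rw [Ray.equivalent_iff, Ray.toEnd_eq_iff]

theorem HasUncountableSun.rays_or_doubleRays {ω : G.RayEnd} (h : HasUncountableSun ω) :
    HasUncountablyManyDominatingRays ω ∨ HasUncountablyManyDoubleRays ω := by
  obtain ⟨I, P, leaf, hI, h⟩ := h
  rcases h.proper with hD | hR
  · right
    have hD' : ∀ i, ∃ D : G.DoubleRay, D.verts = (P i).verts ∧ D.bwd.toEnd = ω ∧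
        D.fwd.toEnd = leaf i := by
      intro i
      obtain ⟨D, hD⟩ := hD i
      have hP := (h.isGeneralisedPath i).2
      rw [hD] at hP ⊢
      rcases hP with ⟨h1, h2⟩ | ⟨h1, h2⟩
      · exact ⟨D, rfl, h1, h2⟩
      · exact ⟨D.reverse, D.verts_reverse, D.bwd_reverse.trans h2, D.fwd_reverse.trans h1⟩
    choose D hDv hDb hDf using hD'
    refine ⟨I, D, hI, fun i j hij => ?_, fun i => ⟨hDb i, ?_⟩, fun i j hij e => ?_⟩
    · rw [hDv, hDv]
      exact h.disjoint i j hij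
    · rw [hDf]
      exact (h.isGeneralisedPath i).1.symm
    · rw [Ray.equivalent_iff_toEnd_eq, hDf, hDf] at e
      exact hij (h.leaf_injective e)
  · left
    choose R hR hRl hdom using hR
    refine ⟨I, R, hI, fun i j hij => ?_, fun i j hij e => ?_, hdom⟩
    · have := h.disjoint i j hij
      rwa [hR, hR] at this
    · rw [Ray.equivalent_iff_toEnd_eq, hRl, hRl] at e
      exact hij (h.leaf_injective e)

theorem HasUncountablyManyDoubleRays.hasUncountableSun {ω : G.RayEnd}
    (h : HasUncountablyManyDoubleRays ω) : HasUncountableSun ω := by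
  obtain ⟨I, D, hI, hdisj, hω, hne⟩ := h
  refine ⟨I, fun i => .double (D i), fun i => (D i).fwd.toEnd, hI, ⟨fun i => ?_, hdisj, ?_⟩,
    .inl fun i => ⟨D i, rfl⟩⟩
  · exact ⟨(hω i).2.symm, .inl ⟨(hω i).1, rfl⟩⟩
  · intro i j e
    by_contra hij
    exact hne i j hij (Ray.equivalent_iff_toEnd_eq.2 e)

theorem HasUncountablyManyDominatingRays.hasUncountableSun {ω : G.RayEnd}
    (h : HasUncountablyManyDominatingRays ω) : HasUncountableSun ω := by
  obtain ⟨I, R, hI, hdisj, hne, hdom⟩ := h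
  have hinj : Function.Injective fun i => (R i).toEnd := by
    intro i j e
    by_contra hij
    exact hne i j hij (Ray.equivalent_iff_toEnd_eq.2 e)
  refine ⟨{i // (R i).toEnd ≠ ω}, fun i => .ray (R i), fun i => (R i).toEnd, ?_,
    ⟨fun i => ?_, fun i j hij => hdisj i j (Subtype.coe_injective.ne hij),
      hinj.comp Subtype.coe_injective⟩, .inr fun i => ⟨R i, rfl, rfl, hdom i⟩⟩
  · rw [← not_countable_iff]
    intro hc
    have h1 : {i | (R i).toEnd ≠ ω}.Countable := hc
    have h2 : {i | (R i).toEnd = ω}.Countable :=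
      Set.Subsingleton.countable fun i hi j hj => hinj ((hi : _ = ω).trans (Eq.symm hj))
    refine not_countable (α := I) (Set.countable_univ_iff.1 ((h1.union h2).mono fun i _ => ?_))
    exact (em ((R i).toEnd = ω)).symm
  · exact ⟨i.2.symm, .inr ⟨rfl, hdom i⟩⟩

/-! ### Families of compatible beams -/

/-- A potential member of a sun centred at `ω`, together with a finite set separating its leaf
from `ω`. -/
structure Beam (ω : G.RayEnd) where
  path : G.PathLike
  leaf : G.RayEnd
  sep : Finset V
  comp_ne : leaf.comp sep ≠ ω.comp sep
  double_or_ray : (∃ D : G.DoubleRay, path = .double D ∧ D.bwd.toEnd = ω ∧ D.fwd.toEnd = leaf) ∨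
    ∃ R : G.Ray, path = .ray R ∧ R.toEnd = leaf ∧ Dominates (R.vert 0) ω

/-- The component in which the leaf of a beam lives. -/
def Beam.leafComp {ω : G.RayEnd} (b : Beam ω) : Set V := b.leaf.comp b.sep

/-- Beams that may occur together in a sun with a star-decomposition. -/
def Beam.Compatible {ω : G.RayEnd} (b b' : Beam ω) : Prop :=
  Disjoint b.path.verts b'.path.verts ∧
    ∀ x ∈ b.leafComp, ∀ y ∈ b'.leafComp, x ≠ y ∧ ¬ G.Adj x y

theorem Beam.Compatible.symm {ω : G.RayEnd} {b b' : Beam ω} (h : b.Compatible b') :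
    b'.Compatible b :=
  ⟨h.1.symm, fun x hx y hy => ⟨(h.2 y hy x hx).1.symm, fun e => (h.2 y hy x hx).2 e.symm⟩⟩

theorem Beam.not_compatible_self {ω : G.RayEnd} (b : Beam ω) : ¬ b.Compatible b := fun h => by
  obtain ⟨x, hx⟩ := (b.leaf.comp b.sep).nonempty
  exact (h.2 x hx x hx).1 rfl

theorem PathLike.countable_verts (P : G.PathLike) : P.verts.Countable := by
  cases P with
  | double D => exact Set.countable_range _
  | finite p => exact (List.finite_toSet p.1.support).countable
  | ray R => exact Set.countable_range _

/-- Let `K` be a connected set that contains a ray in `ω'`. If `K` cannot be separated from `ω` or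
contains a vertex dominating `ω`, then some ray or double ray in `K` links `ω'` to `ω`. -/
theorem exists_pathLike {ω ω' : G.RayEnd} (hne : ω' ≠ ω) {K : Set V} (hK : G.ConnectedSet K)
    {S : G.Ray} (hS : S.toEnd = ω') (hSK : S.verts ⊆ K)
    (hω : ω.direction.Meets K ∨ ∃ v ∈ K, ω.direction.DominatedBy v) :
    ∃ P : G.PathLike, P.verts ⊆ K ∧
      ((∃ D : G.DoubleRay, P = .double D ∧ D.bwd.toEnd = ω ∧ D.fwd.toEnd = ω') ∨
        ∃ R : G.Ray, P = .ray R ∧ R.toEnd = ω' ∧ Dominates (R.vert 0) ω) := by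
  by_cases hdom : ∃ v ∈ K, ω.direction.DominatedBy v
  · obtain ⟨v, hvK, hv⟩ := hdom
    obtain ⟨R, hR0, hRK, i, m, hR⟩ := S.exists_ray_from hK hSK hvK
    refine ⟨.ray R, hRK, .inr ⟨R, rfl, (Ray.toEnd_eq_of_shift hR).trans hS, ?_⟩⟩
    rw [hR0]
    exact dominates_of_dominatedBy hv
  · replace hω := hω.resolve_right hdom
    push Not at hdom
    obtain ⟨R, hRK, hR⟩ := hω.exists_ray hK hdom
    have hRω : R.toEnd = ω := RayEnd.ext_comp hR
    obtain ⟨D, hDK, hDb, hDf⟩ := exists_doubleRay hK hRK hSK (by rw [hRω, hS]; exact hne.symm)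
    exact ⟨.double D, hDK, .inl ⟨D, rfl, hDb.trans hRω, hDf.trans hS⟩⟩

/-- If no vertex of `K` dominates `f` and `K` is separated from `f` by a finite set, then some
finite set separates even the neighbours of `K` from `f`. -/
theorem Direction.exists_separator_of_not_meets {f : G.Direction} {K : Set V} (hf : ¬ f.Meets K)
    (hdom : ∀ v ∈ K, ¬ f.DominatedBy v) : ∃ Z : Finset V, (∀ x ∈ K, x ∉ f.comp Z) ∧
      ∀ x ∈ K, ∀ y, G.Adj x y → y ∉ f.comp Z := by
  classical
  simp only [Direction.Meets, not_forall, not_exists, not_and] at hf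
  obtain ⟨Z, hZ⟩ := hf
  have hsep : ∀ v, ∃ X : Finset V, v ∈ K → v ∉ X ∧ v ∉ f.comp X := by
    intro v
    by_cases hv : v ∈ K
    · obtain ⟨X, hX⟩ := Direction.exists_separator (hdom v hv)
      exact ⟨X, fun _ => hX⟩
    · exact ⟨∅, fun h => absurd h hv⟩
  choose X hX using hsep
  refine ⟨Z ∪ Z.biUnion X, fun x hx hx' => hZ x hx (f.comp_anti Finset.subset_union_left hx'), ?_⟩
  intro x hx y hxy hy
  by_cases hxZ : x ∈ Z
  · exact Direction.not_adj_comp (hX x hx).1 (hX x hx).2 (f.comp_anti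
      ((Finset.subset_biUnion_of_mem X hxZ).trans Finset.subset_union_right) hy) hxy
  · exact Direction.not_adj_comp hxZ (hZ x hx) (f.comp_anti Finset.subset_union_left hy) hxy

/-- An end that the finite subsets of a capturing set `W` do not distinguish from `ω` is linked to
`ω` outside `W`. -/
theorem RayEnd.CapturedBy.exists_pathLike {ω ω' : G.RayEnd} {W : Set V} (hW : ω.CapturedBy W)
    (hne : ω' ≠ ω) (hω' : ∀ X : Finset V, (X : Set V) ⊆ W → ω'.comp X = ω.comp X)
    {Y : Finset V} (hY : ω'.comp Y ≠ ω.comp Y) :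
    ∃ P : G.PathLike, Disjoint P.verts W ∧
      ((∃ D : G.DoubleRay, P = .double D ∧ D.bwd.toEnd = ω ∧ D.fwd.toEnd = ω') ∨
        ∃ R : G.Ray, P = .ray R ∧ R.toEnd = ω' ∧ Dominates (R.vert 0) ω) := by
  obtain ⟨X, hXY⟩ := exists_finset_inter Y W
  have hdisj := hW.disjoint_comp hXY (hω' X (hXY ▸ Set.inter_subset_right)) hY
  obtain ⟨c, hc⟩ := (ω'.comp Y).nonempty
  let K : Set V := {y | G.Joined Wᶜ c y}
  have hK : G.ConnectedSet K := connectedSet_component _ c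
  have hKW : Disjoint K W := Set.disjoint_left.2 fun y hy => hy.right_mem
  have hcK : c ∈ K := Joined.refl (Set.disjoint_left.1 hdisj hc)
  have hCK : (ω'.comp Y : Set V) ⊆ K := fun y hy =>
    ((ω'.comp Y).connectedSet c hc y hy).mono (Set.disjoint_left.1 hdisj)
  obtain ⟨S, hS⟩ := ω'.exists_ray
  obtain ⟨N, hN⟩ := S.comp_hasTailIn Y
  have hSK : (S.drop N).verts ⊆ K := by
    rintro _ ⟨k, rfl⟩
    refine hCK ?_
    rw [← hS, Ray.toEnd_comp]
    exact hN _ (Nat.le_add_right _ _)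
  by_cases hω : ω.direction.Meets K ∨ ∃ v ∈ K, ω.direction.DominatedBy v
  · obtain ⟨P, hPK, hP⟩ := SimpleGraph.exists_pathLike hne hK ((S.toEnd_drop N).trans hS) hSK hω
    exact ⟨P, hKW.mono_left hPK, hP⟩
  obtain ⟨hmeets, hdom⟩ := not_or.1 hω
  push Not at hdom
  exfalso
  obtain ⟨Z, hZ, hZ'⟩ := Direction.exists_separator_of_not_meets hmeets hdom
  obtain ⟨X', hX'Z⟩ := exists_finset_inter Z W
  have hX'W : (X' : Set V) ⊆ W := hX'Z ▸ Set.inter_subset_right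
  have hcX' : c ∈ ω.comp X' :=
    hω' X' hX'W ▸ ω'.comp_subset_of_disjoint (hdisj.mono_right hX'W) hc
  obtain ⟨d, hd⟩ := (ω.comp Z).nonempty
  have hdX' : d ∈ ω.comp X' :=
    ω.comp_anti (Finset.coe_subset.1 (hX'Z ▸ Set.inter_subset_left)) hd
  obtain ⟨a, b, ha, -, hbX', hb, hab⟩ := ((ω.comp X').connectedSet c hcX' d hdX').exists_adj_leaving
    (B := K) hcK fun h => hZ d h hd
  have hbW : b ∈ W := by
    by_contra hbW
    exact hb (Joined.trans ha (.of_adj hab ha.right_mem hbW))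
  exact hZ' a ha b hab (hW X' Z hX'Z b hbW hbX')

theorem RayEnd.exists_compatible_beam {ω : G.RayEnd} (h : ¬ ω.direction.CountablyDetermined)
    {S : Set (Beam ω)} (hS : S.Countable) : ∃ b : Beam ω, ∀ b' ∈ S, b'.Compatible b := by
  obtain ⟨W, hWc, hUW, hW⟩ := ω.exists_capturedBy
    (hS.biUnion fun b _ => b.path.countable_verts.union b.sep.countable_toSet)
  have hSW : ∀ b ∈ S, b.path.verts ∪ (b.sep : Set V) ⊆ W := fun b hb =>
    (Set.subset_biUnion_of_mem (u := fun b : Beam ω => b.path.verts ∪ (b.sep : Set V)) hb).trans hUW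
  obtain ⟨ω', hne, hω'⟩ : ∃ ω' : G.RayEnd, ω' ≠ ω ∧
      ∀ X : Finset V, (X : Set V) ⊆ W → ω'.comp X = ω.comp X := by
    by_contra hcon
    push Not at hcon
    refine h ⟨(fun X : Finset V => ⟨X, ω.comp X⟩) '' {X : Finset V | (X : Set V) ⊆ W},
      (countable_finsets_subset hWc).image _, fun g hg => ?_⟩
    obtain ⟨ω', rfl⟩ := RayEnd.direction_surjective g
    obtain ⟨X, hX, hX'⟩ := hcon ω' fun e => hg (by rw [e])
    exact ⟨_, ⟨X, hX, rfl⟩, rfl, hX'⟩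
  obtain ⟨Y, hY⟩ := RayEnd.exists_comp_ne hne
  obtain ⟨X, hXY⟩ := exists_finset_inter Y W
  have hdisj := hW.disjoint_comp hXY (hω' X (hXY ▸ Set.inter_subset_right)) hY
  obtain ⟨P, hPW, hP⟩ := hW.exists_pathLike hne hω' hY
  refine ⟨⟨P, ω', Y, hY, hP⟩, fun b hb => ⟨?_, ?_⟩⟩
  · exact (hPW.mono_right (Set.subset_union_left.trans (hSW b hb))).symm
  · have hsep : (b.sep : Set V) ⊆ W := Set.subset_union_right.trans (hSW b hb)
    have hsub : (ω'.comp Y : Set V) ⊆ ω.comp b.sep :=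
      hω' b.sep hsep ▸ ω'.comp_subset_of_disjoint (hdisj.mono_right hsep)
    intro x hx y hy
    refine ⟨?_, fun hxy => b.comp_ne (ComponentCompl.eq_of_mem hx ?_)⟩
    · rintro rfl
      exact b.comp_ne (ComponentCompl.eq_of_mem hx (hsub hy))
    · exact ComponentCompl.mem_of_adj y x (hsub hy) (ComponentCompl.notMem_of_mem hx) hxy.symm

theorem RayEnd.exists_uncountable_compatible {ω : G.RayEnd}
    (h : ¬ ω.direction.CountablyDetermined) :
    ∃ S : Set (Beam ω), ¬ S.Countable ∧ S.Pairwise Beam.Compatible := by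
  obtain ⟨S, hS⟩ := zorn_subset {S : Set (Beam ω) | S.Pairwise Beam.Compatible} fun c hc hchain =>
    ⟨⋃₀ c, (Set.pairwise_sUnion hchain.directedOn).2 hc, fun s hs => Set.subset_sUnion_of_mem hs⟩
  refine ⟨S, fun hc => ?_, hS.prop⟩
  obtain ⟨b, hb⟩ := RayEnd.exists_compatible_beam h hc
  have hins : (insert b S).Pairwise Beam.Compatible :=
    hS.prop.insert fun b' hb' _ => ⟨(hb b' hb').symm, hb b' hb'⟩
  exact b.not_compatible_self (hb b (hS.le_of_ge hins (Set.subset_insert _ _) (Set.mem_insert _ _)))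

/-! ### Star-decompositions -/

theorem eq_end_of_mem_support_starGraph {I : Type u} {t₁ t₃ : Option I}
    {p : (starGraph (none : Option I)).Walk t₁ t₃} (hp : p.IsPath) {i : I}
    (hi : some i ∈ p.support) : some i = t₁ ∨ some i = t₃ := by
  obtain ⟨n, hn, hnl⟩ := Walk.mem_support_iff_exists_getVert.1 hi
  rcases Nat.eq_zero_or_pos n with rfl | hpos
  · exact .inl (by rw [← hn, Walk.getVert_zero])
  rcases hnl.eq_or_lt with rfl | hlt
  · exact .inr (by rw [← hn, Walk.getVert_length])
  exfalso
  have h1 := p.adj_getVert_succ hlt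
  have h2 := p.adj_getVert_succ (i := n - 1) (by omega)
  rw [Nat.sub_add_cancel hpos] at h2
  rw [hn, starGraph_adj] at h1 h2
  have e1 : p.getVert (n + 1) = none := h1.2.resolve_left (by simp)
  have e2 : p.getVert (n - 1) = none := h2.2.resolve_right (by simp)
  have := hp.getVert_injOn (Set.mem_ofPred.2 hlt) (Set.mem_ofPred.2 (by omega : n - 1 ≤ p.length))
    (e1.trans e2.symm)
  omega

/-- The parts of the star-decomposition whose leaf parts are the sets `C i` with their
neighbours. -/
def starParts {I : Type u} (G : SimpleGraph V) (C : I → Set V) : Option I → Set V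
  | none => {v | ∀ i, v ∉ C i}
  | some i => {v | v ∈ C i ∨ ∃ x ∈ C i, G.Adj x v}

theorem isStarDecomposition_starParts {I : Type u} {C : I → Set V}
    (hC : ∀ i j, i ≠ j → ∀ x ∈ C i, ∀ y ∈ C j, x ≠ y ∧ ¬ G.Adj x y)
    (hfin : ∀ i, {v | v ∉ C i ∧ ∃ x ∈ C i, G.Adj x v}.Finite) :
    IsStarDecompositionOfFiniteAdhesion G (starParts G C) := by
  have honly : ∀ {v i t}, v ∈ C i → v ∈ starParts G C t → t = some i := by
    rintro v i (_ | j) hv ht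
    · exact absurd hv (ht i)
    · by_contra hij
      have hij : i ≠ j := fun e => hij (by rw [e])
      rcases ht with h | ⟨x, hx, hxv⟩
      · exact (hC i j hij v hv v h).1 rfl
      · exact (hC i j hij v hv x hx).2 hxv.symm
  refine ⟨⟨isTree_starGraph _, ?_, ?_, ?_⟩, ?_⟩
  · refine Set.eq_univ_of_forall fun v => Set.mem_iUnion.2 ?_
    by_cases hv : ∃ i, v ∈ C i
    · obtain ⟨i, hi⟩ := hv
      exact ⟨some i, .inl hi⟩
    · exact ⟨none, fun i hi => hv ⟨i, hi⟩⟩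
  · intro x y hxy
    by_cases hx : ∃ i, x ∈ C i
    · obtain ⟨i, hi⟩ := hx
      exact ⟨some i, .inl hi, .inr ⟨x, hi, hxy⟩⟩
    by_cases hy : ∃ i, y ∈ C i
    · obtain ⟨i, hi⟩ := hy
      exact ⟨some i, .inr ⟨y, hi, hxy.symm⟩, .inl hi⟩
    · exact ⟨none, fun i hi => hx ⟨i, hi⟩, fun i hi => hy ⟨i, hi⟩⟩
  · rintro t₁ t₂ t₃ p hp ht₂ v ⟨hv₁, hv₃⟩
    rcases t₂ with _ | i
    · intro i hi
      obtain rfl := honly hi hv₁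
      obtain rfl := honly hi hv₃
      rw [Walk.nil_iff_support_eq.1 (Walk.isPath_iff_nil.1 hp)] at ht₂
      simp at ht₂
    · rcases eq_end_of_mem_support_starGraph hp ht₂ with h | h
      · exact h ▸ hv₁
      · exact h ▸ hv₃
  · have key : ∀ i, (starParts G C none ∩ starParts G C (some i)).Finite := by
      refine fun i => (hfin i).subset ?_
      rintro v ⟨hv, hv'⟩
      exact ⟨hv i, hv'.resolve_left (hv i)⟩
    rintro (_ | i) (_ | j) h
    · exact absurd rfl h.ne
    · exact key j
    · rw [Set.inter_comm]
      exact key i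
    · simp [starGraph_adj] at h

theorem RayEnd.livesIn_of_comp_subset {ω : G.RayEnd} {X : Finset V} {A : Set V}
    (h : (ω.comp X : Set V) ⊆ A) : ω.LivesIn A := by
  rintro R rfl
  have hinj : Function.Injective fun n => R.vert (R.idx X + n) := fun m n e => by
    simpa using R.inj e
  exact Set.infinite_of_injective_forall_mem hinj fun n =>
    ⟨⟨_, rfl⟩, h (R.vert_mem_comp X (Nat.le_add_right _ _))⟩

theorem RayEnd.livesIn_starParts_none {I : Type u} {C : I → Set V} {ω : G.RayEnd}
    (hC : ∀ i j, i ≠ j → ∀ x ∈ C i, ∀ y ∈ C j, x ≠ y ∧ ¬ G.Adj x y)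
    (hω : ∀ i, ∃ X : Finset V, Disjoint (C i) (ω.comp X : Set V)) :
    ω.LivesIn (starParts G C none) := by
  rintro R rfl hfin
  obtain ⟨N, hN⟩ := R.exists_avoids hfin.toFinset
  have hmem : ∀ n, N ≤ n → ∃ i, R.vert n ∈ C i := by
    intro n hn
    by_contra hcon
    push Not at hcon
    exact hN n hn (by simpa using ⟨⟨n, rfl⟩, hcon⟩)
  obtain ⟨i, hi⟩ := hmem N le_rfl
  have htail : ∀ n, N ≤ n → R.vert n ∈ C i := by
    intro n hn
    induction n, hn using Nat.le_induction with
    | base => exact hi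
    | succ n hn ih =>
      obtain ⟨j, hj⟩ := hmem (n + 1) (by omega)
      by_contra hcon
      exact (hC i j (fun e => hcon (e ▸ hj)) _ ih _ hj).2 (R.adj n)
  obtain ⟨X, hX⟩ := hω i
  exact Set.disjoint_left.1 hX (htail _ (le_max_left N (R.idx X)))
    (R.vert_mem_comp X (le_max_right _ _))

theorem Beam.path_hasTailIn {ω : G.RayEnd} (b : Beam ω) {A : Set V} (hA : b.leafComp ⊆ A) :
    b.path.HasTailIn A := by
  have key : ∀ R : G.Ray, R.toEnd = b.leaf → R.HasTailIn A := by
    intro R hR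
    obtain ⟨N, hN⟩ := R.comp_hasTailIn b.sep
    refine ⟨N, fun n hn => hA ?_⟩
    rw [Beam.leafComp, ← hR]
    exact hN n hn
  rcases b.double_or_ray with ⟨D, hD, -, h⟩ | ⟨R, hR, h, -⟩
  · rw [hD]
    exact .inr (key _ h)
  · rw [hR]
    exact key _ h

theorem Beam.isGeneralisedPath {ω : G.RayEnd} (b : Beam ω) :
    IsGeneralisedPath b.path ω b.leaf := by
  refine ⟨fun e => b.comp_ne (by rw [← e]), ?_⟩
  rcases b.double_or_ray with ⟨D, hD, h, h'⟩ | ⟨R, hR, h, h'⟩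
  · rw [hD]
    exact .inl ⟨h, h'⟩
  · rw [hR]
    exact .inr ⟨h, h'⟩

/-- There is an uncountable sun centred at `ω` whose leaves are separated from `ω` by a
star-decomposition. -/
def HasUncountableSunWithDecomposition (ω : G.RayEnd) : Prop :=
  ∃ (I : Type u) (P : I → G.PathLike) (leaf : I → G.RayEnd) (𝒱 : Option I → Set V),
    Uncountable I ∧ IsSun ω P leaf ∧ IsStarDecompositionOfFiniteAdhesion G 𝒱 ∧
    ω.LivesIn (𝒱 none) ∧ ∀ i, (leaf i).LivesIn (𝒱 (some i)) ∧ (P i).HasTailIn (𝒱 (some i))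

theorem hasUncountableSunWithDecomposition_of_beams {ω : G.RayEnd} {S : Set (Beam ω)}
    (hS : ¬ S.Countable) (hcompat : S.Pairwise Beam.Compatible)
    (hproper : (∀ b ∈ S, ∃ D : G.DoubleRay, b.path = .double D) ∨
      ∀ b ∈ S, ∃ R : G.Ray, b.path = .ray R ∧ R.toEnd = b.leaf ∧ Dominates (R.vert 0) ω) :
    HasUncountableSunWithDecomposition ω := by
  have hC : ∀ i j : S, i ≠ j → ∀ x ∈ i.1.leafComp, ∀ y ∈ j.1.leafComp, x ≠ y ∧ ¬ G.Adj x y :=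
    fun i j hij => (hcompat i.2 j.2 (Subtype.coe_injective.ne hij)).2
  have hleaf : ∀ i j : S, i.1.leaf = j.1.leaf → i = j := by
    intro i j e
    by_contra hij
    obtain ⟨R, hR⟩ := i.1.leaf.exists_ray
    have h1 := R.vert_mem_comp i.1.sep (le_max_left _ (R.idx j.1.sep))
    have h2 := R.vert_mem_comp j.1.sep (le_max_right (R.idx i.1.sep) _)
    rw [← Ray.toEnd_comp, hR] at h1 h2
    exact (hC i j hij _ h1 _ (by rw [Beam.leafComp, ← e]; exact h2)).1 rfl
  refine ⟨S, fun b => b.1.path, fun b => b.1.leaf, starParts G fun b : S => b.1.leafComp,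
    not_countable_iff.1 hS, ⟨⟨fun b => b.1.isGeneralisedPath, fun i j hij =>
      (hcompat i.2 j.2 (Subtype.coe_injective.ne hij)).1, fun i j => hleaf i j⟩, ?_⟩,
    isStarDecomposition_starParts hC fun b => ?_, RayEnd.livesIn_starParts_none hC fun b => ?_,
    fun b => ⟨RayEnd.livesIn_of_comp_subset (X := b.1.sep) fun v hv => .inl hv,
      b.1.path_hasTailIn fun v hv => .inl hv⟩⟩
  · exact hproper.imp (fun h b => h b.1 b.2) fun h b => h b.1 b.2
  · refine b.1.sep.finite_toSet.subset ?_
    rintro v ⟨hv, x, hx, hxv⟩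
    by_contra hvX
    exact hv (ComponentCompl.mem_of_adj x v hx hvX hxv)
  · exact ⟨b.1.sep, ComponentCompl.pairwise_disjoint b.1.comp_ne⟩

theorem RayEnd.hasUncountableSunWithDecomposition {ω : G.RayEnd}
    (h : ¬ ω.direction.CountablyDetermined) : HasUncountableSunWithDecomposition ω := by
  obtain ⟨S, hS, hcompat⟩ := RayEnd.exists_uncountable_compatible h
  by_cases hD : (S ∩ {b | ∃ D : G.DoubleRay, b.path = .double D}).Countable
  · refine hasUncountableSunWithDecomposition_of_beams
      (S := S \ {b | ∃ D : G.DoubleRay, b.path = .double D}) (fun hR => hS ?_)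
      (hcompat.mono Set.sdiff_subset) (.inr fun b hb => ?_)
    · rw [← Set.inter_union_sdiff S {b | ∃ D : G.DoubleRay, b.path = .double D}]
      exact hD.union hR
    · rcases b.double_or_ray with ⟨D, hD, -⟩ | h
      · exact absurd ⟨D, hD⟩ hb.2
      · exact h
  · exact hasUncountableSunWithDecomposition_of_beams hD (hcompat.mono Set.inter_subset_left)
      (.inl fun b hb => hb.2)

end SimpleGraph

end

theorem theorem2 {V : Type u} (G : SimpleGraph V) :
    -- ends and directions correspond bijectively
    Function.Bijective (SimpleGraph.RayEnd.direction : G.RayEnd → G.Direction) ∧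
    ∀ (f : G.Direction) (ω : G.RayEnd), ω.direction = f →
      List.TFAE
        [¬ f.CountablyDetermined,
          ¬ (𝓝 ω).IsCountablyGenerated,
          SimpleGraph.HasUncountableSun ω,
          SimpleGraph.HasUncountablyManyDominatingRays ω ∨
            SimpleGraph.HasUncountablyManyDoubleRays ω] ∧
      (SimpleGraph.HasUncountableSun ω →
        ∃ (I : Type u) (P : I → G.PathLike) (leaf : I → G.RayEnd) (𝒱 : Option I → Set V),
          Uncountable I ∧ SimpleGraph.IsSun ω P leaf ∧
          SimpleGraph.IsStarDecompositionOfFiniteAdhesion G 𝒱 ∧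
          ω.LivesIn (𝒱 none) ∧
          ∀ i, (leaf i).LivesIn (𝒱 (some i)) ∧ (P i).HasTailIn (𝒱 (some i))) := by
  refine ⟨⟨SimpleGraph.RayEnd.direction_injective, SimpleGraph.RayEnd.direction_surjective⟩, ?_⟩
  rintro _ ω rfl
  refine ⟨?_, fun h =>
    SimpleGraph.RayEnd.hasUncountableSunWithDecomposition h.not_countablyDetermined⟩
  tfae_have 1 → 2 :=
    mt SimpleGraph.RayEnd.countablyDetermined_of_isCountablyGenerated
  tfae_have 2 → 1 :=
    mt SimpleGraph.RayEnd.isCountablyGenerated_of_countablyDetermined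
  tfae_have 1 → 3 := fun h => by
    obtain ⟨I, P, leaf, -, hI, hsun, -⟩ :=
      SimpleGraph.RayEnd.hasUncountableSunWithDecomposition h
    exact ⟨I, P, leaf, hI, hsun⟩
  tfae_have 3 → 1 := SimpleGraph.HasUncountableSun.not_countablyDetermined
  tfae_have 3 → 4 := SimpleGraph.HasUncountableSun.rays_or_doubleRays
  tfae_have 4 → 3 := fun h => h.elim
    SimpleGraph.HasUncountablyManyDominatingRays.hasUncountableSun
    SimpleGraph.HasUncountablyManyDoubleRays.hasUncountableSun
  tfae_finish
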